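/- Let $d\ge 2$, let $\omega\subset\mathbb{R}^{d-1}$ be a bounded open set, $\ell,T>0$, $\alpha\in(0,1)$, $\Omega=\omega\times(-\ell,\ell)$, and write $x=(x',x_d)\in\Omega$. Let $a=[a_{ij}]$ be a measurable, symmetric matrix-valued function on $\Omega\times(0,T)$ such that, for some $\lambda\in(0,1)$, $\lambda|\xi|^2\le a(x,t)\xi\cdot\xi\le\lambda^{-1}|\xi|^2$ for almost all $(x,t)$ and all $\xi\in\mathbb{R}^d$; let $0\le q\in L^\infty(\Omega\times(0,T))$ and $R\in L^\infty(\Omega\times(0,T))$. Put $\mathcal{A}(t)u=-\sum_{i,j}\partial_{x_i}(a_{ij}\partial_{x_j}u)+qu$. Let $V$ be the closure in $H^1(\Omega)$ of the restrictions to $\Omega$ of $C_c^\infty(\omega\times\mathbb{R})$ (the $H^1(\Omega)$ functions that vanish on $\partial\omega\times(-\ell,\ell)$), and let $${}_0I_t^{1-\alpha}u(t)=\frac1{\Gamma(1-\alpha)}\int_0^t(t-s)^{-\alpha}u(s)\,ds,\qquad {}_tI_T^{1-\alpha}v(t)=\frac1{\Gamma(1-\alpha)}\int_t^T(s-t)^{-\alpha}v(s)\,ds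 .$$ *Direct problem.* For $f\in L^2(0,T;L^2(\omega))$, $u_f\in L^2(0,T;V)$ denotes the weak solution of $\partial_t^\alpha u+\mathcal{A}(t)u=f(x',t)R(x,t)$ in $\Omega\times(0,T)$ with $u(0)=0$, zero Neumann (co-normal) data on $x_d=\pm\ell$ and $u=0$ on $\partial\omega\times(-\ell,\ell)\times(0,T)$, where $\partial_t^\alpha$ is the Djrbashian–Caputo derivative; that is, $$-\int_0^T\!\!\int_\Omega ({}_0I_t^{1-\alpha}u)\,\partial_t\phi\,dx\,dt+\int_0^T\!\!\int_\Omega (a\nabla u\cdot\nabla\phi+qu\phi)\,dx\,dt=\int_0^T\!\!\int_\Omega fR\phi\,dx\,dt\quad\text{for all }\phi\in C_c^\infty(\omega\times\mathbb{R}\times(-\infty,T)).$$ *Adjoint problem.* For $\psi\in L^2(0,T;L^2(\omega))$, $v\in L^2(0,T;V)$ is a weak solution of $-\partial_t({}_tI_T^{1-\alpha}v)+\mathcal{A}(t)v=0$ in $\Omega\times(0,T)$ with ${}_tI_T^{1-\alpha}v(T)=0$, Neumann (co-normal) data $\sum_j a_{dj}\partial_{x_j}v=\psi$ on $x_d=\ell$,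 zero Neumann data on $x_d=-\ell$ and $v=0$ on $\partial\omega\times(-\ell,\ell)\times(0,T)$, if $$\int_0^T\!\!\int_\Omega ({}_tI_T^{1-\alpha}v)\,\partial_t\phi\,dx\,dt+\int_0^T\!\!\int_\Omega (a\nabla v\cdot\nabla\phi+qv\phi)\,dx\,dt=\int_0^T\!\!\int_\omega \psi\,\phi(x',\ell,t)\,dx'\,dt\quad\text{for all }\phi\in C_c^\infty(\omega\times\mathbb{R}\times(0,\infty)).$$ Then for every $f$ the direct problem has exactly one weak solution $u_f$, and for every $\psi$ the adjoint problem has exactly one weak solution. Let $g^\delta\in L^2(0,T;L^2(\omega))$ and $$J(f)=\tfrac12\big\|u_f|_{\omega\times\{\ell\}\times(0,T)}-g^\delta\big\|^2_{L^2(0,T;L^2(\omega))},\qquad f\in L^2(0,T;L^2(\omega)).$$ Then $J$ is Fréchet differentiable on $L^2(0,T;L^2(\omega))$ and, for every $f$, its gradient is $$J'(f)(x',t)=\int_{-\ell}^{\ell}R(x',x_d,t)\,v(x',x_d,t)\,dx_d\in L^2(0,T;L^2(\omega)),$$ where $v$ is the weak solution of the adjoint problem with $\psi=u_f|_{\omega\times\{\ell\}\times(0,T)}-g^\delta$.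 -/

import Mathlib

open MeasureTheory Set Filter Topology

namespace Subdiffusion

/-- Points `((x', x_d), t)` of space-time, with `x' ∈ ℝⁿ` and `d = n + 1`. -/
abbrev SpaceTime (n : ℕ) : Type := (EuclideanSpace ℝ (Fin n) × ℝ) × ℝ

/-- Points `(x', t)`, used for functions on `ω × (0,T)`. -/
abbrev Lateral (n : ℕ) : Type := EuclideanSpace ℝ (Fin n) × ℝ

/-- The left-sided Riemann-Liouville fractional integral of order `β`, based at `0`. -/
noncomputable def leftFracInt (β : ℝ) (w : ℝ → ℝ) (t : ℝ) : ℝ :=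
  (Real.Gamma β)⁻¹ * ∫ s in (0 : ℝ)..t, (t - s) ^ (β - 1) * w s

/-- The right-sided Riemann-Liouville fractional integral of order `β`, based at `T`. -/
noncomputable def rightFracInt (β T : ℝ) (w : ℝ → ℝ) (t : ℝ) : ℝ :=
  (Real.Gamma β)⁻¹ * ∫ s in t..T, (s - t) ^ (β - 1) * w s

/-- The coordinate direction `e_i` of `ℝᵈ = ℝⁿ × ℝ`; the last one is the direction of `x_d`. -/
noncomputable def dir (n : ℕ) : Fin (n + 1) → EuclideanSpace ℝ (Fin n) × ℝ :=
  Fin.lastCases (0, 1) (fun i => (EuclideanSpace.single i 1, 0))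

/-- The spatial partial derivative `∂Φ/∂x_i`. -/
noncomputable def dx {n : ℕ} (i : Fin (n + 1)) (Φ : SpaceTime n → ℝ) (p : SpaceTime n) : ℝ :=
  fderiv ℝ Φ p (dir n i, 0)

/-- The time derivative `∂Φ/∂t`. -/
noncomputable def dt {n : ℕ} (Φ : SpaceTime n → ℝ) (p : SpaceTime n) : ℝ :=
  fderiv ℝ Φ p (0, 1)

/-- The data of the direct problem: the cross section `ω`, the half height `ℓ` of the cylinder
`Ω = ω × (-ℓ, ℓ)`, the final time `T`, the order `α`, the coefficients `a`, `q` of the elliptic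
operator `𝒜(t) u = - ∑ ∂_i (a_ij ∂_j u) + q u`, and the known factor `R` of the source. -/
structure Problem (n : ℕ) where
  ω : Set (EuclideanSpace ℝ (Fin n))
  ℓ : ℝ
  T : ℝ
  α : ℝ
  a : SpaceTime n → Matrix (Fin (n + 1)) (Fin (n + 1)) ℝ
  q : SpaceTime n → ℝ
  R : SpaceTime n → ℝ

namespace Problem

variable {n : ℕ} (P : Problem n)

/-- Lebesgue measure on `Q = Ω × (0,T)`, where `Ω = ω × (-ℓ, ℓ)`. -/
noncomputable def measQ : Measure (SpaceTime n) :=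
  volume.restrict ((P.ω ×ˢ Ioo (-P.ℓ) P.ℓ) ×ˢ Ioo 0 P.T)

/-- Lebesgue measure on `ω × (0,T)`. -/
noncomputable def measS : Measure (Lateral n) :=
  volume.restrict (P.ω ×ˢ Ioo 0 P.T)

/-- The space `L²(Ω × (0,T)) = L²(0,T; L²(Ω))`. -/
abbrev L2Q : Type := Lp ℝ 2 P.measQ

/-- The space `L²(ω × (0,T)) = L²(0,T; L²(ω))`. -/
abbrev L2S : Type := Lp ℝ 2 P.measS

/-- The standing assumptions. -/
structure Admissible : Prop where
  isOpen_ω : IsOpen P.ω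
  isBounded_ω : Bornology.IsBounded P.ω
  ℓ_pos : 0 < P.ℓ
  T_pos : 0 < P.T
  α_pos : 0 < P.α
  α_lt_one : P.α < 1
  a_meas : ∀ i j, AEStronglyMeasurable (fun p => P.a p i j) P.measQ
  a_symm : ∀ᵐ p ∂P.measQ, (P.a p).IsSymm
  a_elliptic : ∃ c : ℝ, 0 < c ∧ c < 1 ∧ ∀ᵐ p ∂P.measQ, ∀ ξ : Fin (n + 1) → ℝ,
    c * ∑ i, ξ i ^ 2 ≤ ∑ i, ∑ j, P.a p i j * ξ j * ξ i ∧
      ∑ i, ∑ j, P.a p i j * ξ j * ξ i ≤ c⁻¹ * ∑ i, ξ i ^ 2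
  q_bdd : MemLp P.q ⊤ P.measQ
  q_nonneg : ∀ᵐ p ∂P.measQ, 0 ≤ P.q p
  R_bdd : MemLp P.R ⊤ P.measQ

/-- Smooth functions on space-time that are compactly supported and whose support stays away from
the lateral boundary `∂ω × ℝ × ℝ`; they are unrestricted at `x_d = ±ℓ`, `t = 0` and `t = T`. -/
structure IsTest (Φ : SpaceTime n → ℝ) : Prop where
  smooth : ContDiff ℝ ((⊤ : ℕ∞) : WithTop ℕ∞) Φ
  compact : HasCompactSupport Φ
  lateral : ∀ p ∈ tsupport Φ, p.1.1 ∈ P.ω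

/-- `u` belongs to `L²(0,T; V)`, where `V` is the space of the functions in `H¹(Ω)` that vanish on
`∂ω × (-ℓ, ℓ)`; its spatial gradient is `G` and its trace on `ω × {ℓ} × (0,T)` is `τ`.
The space is the closure of the test functions in the norm of `L²(0,T; H¹(Ω))`, and gradient and
trace are the continuous extensions of those of test functions. -/
def IsEnergy (u : P.L2Q) (G : Fin (n + 1) → P.L2Q) (τ : P.L2S) : Prop :=
  ∃ Φ : ℕ → SpaceTime n → ℝ, (∀ k, P.IsTest (Φ k)) ∧
    Tendsto (fun k => eLpNorm (fun p => Φ k p - u p) 2 P.measQ) atTop (𝓝 0) ∧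
    (∀ i, Tendsto (fun k => eLpNorm (fun p => dx i (Φ k) p - G i p) 2 P.measQ) atTop (𝓝 0)) ∧
    Tendsto (fun k => eLpNorm (fun y : Lateral n => Φ k ((y.1, P.ℓ), y.2) - τ y) 2 P.measS)
      atTop (𝓝 0)

/-- The form `∫_Q (a ∇u · ∇Φ + q u Φ)` of `𝒜(t)`, for `u` with spatial gradient `G`. -/
noncomputable def form (u : P.L2Q) (G : Fin (n + 1) → P.L2Q) (Φ : SpaceTime n → ℝ) : ℝ :=
  ∫ p, ((∑ i, ∑ j, P.a p i j * G j p * dx i Φ p) + P.q p * u p * Φ p) ∂P.measQ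

/-- `u`, with trace `τ` on `ω × {ℓ} × (0,T)`, is a weak solution of the direct problem
`∂_t^α u + 𝒜(t) u = f R` in `Ω × (0,T)`, with `u(0) = 0`, zero (co-normal) Neumann data on `x_d = ±ℓ`,
and `u = 0` on `∂ω × (-ℓ, ℓ) × (0,T)`. For zero initial value the Djrbashian-Caputo derivative is
`∂_t (I^{1-α} u)` with `(I^{1-α} u)(0) = 0`. The time derivative has been moved to the test
function, which vanishes near `t = T` and is arbitrary at `t = 0` and at `x_d = ±ℓ`, so that the
initial condition and the Neumann conditions are part of the identity. -/
def IsDirectSolution (f : P.L2S) (u : P.L2Q) (τ : P.L2S) : Prop :=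
  ∃ G : Fin (n + 1) → P.L2Q, P.IsEnergy u G τ ∧
    ∀ Φ : SpaceTime n → ℝ, P.IsTest Φ → (∀ p ∈ tsupport Φ, p.2 < P.T) →
      -(∫ p, leftFracInt (1 - P.α) (fun s => u (p.1, s)) p.2 * dt Φ p ∂P.measQ) + P.form u G Φ
        = ∫ p, f (p.1.1, p.2) * P.R p * Φ p ∂P.measQ

/-- `v` is a weak solution of the adjoint problem `ᴿ∂_T^α v + 𝒜(t) v = 0` in `Ω × (0,T)`, with
`(I_T^{1-α} v)(T) = 0`, co-normal Neumann data `∑_j a_dj ∂_j v = ψ` on `x_d = ℓ` and `0` on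
`x_d = -ℓ`, and `v = 0` on `∂ω × (-ℓ, ℓ) × (0,T)`. Here `ᴿ∂_T^α v = - ∂_t (I_T^{1-α} v)`, and the test function
vanishes near `t = 0` and is arbitrary at `t = T` and at `x_d = ±ℓ`. -/
def IsAdjointSolution (ψ : P.L2S) (v : P.L2Q) : Prop :=
  ∃ (G : Fin (n + 1) → P.L2Q) (τ : P.L2S), P.IsEnergy v G τ ∧
    ∀ Φ : SpaceTime n → ℝ, P.IsTest Φ → (∀ p ∈ tsupport Φ, 0 < p.2) →
      (∫ p, rightFracInt (1 - P.α) P.T (fun s => v (p.1, s)) p.2 * dt Φ p ∂P.measQ) + P.form v G Φ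
        = ∫ y, ψ y * Φ ((y.1, P.ℓ), y.2) ∂P.measS

/-- The solution `u_f` of the direct problem, together with its trace on `ω × {ℓ} × (0,T)`. -/
noncomputable def solution (f : P.L2S) : P.L2Q × P.L2S :=
  Classical.epsilon fun w : P.L2Q × P.L2S => P.IsDirectSolution f w.1 w.2

/-- The trace of `u_f` on `ω × {ℓ} × (0,T)`. -/
noncomputable def observation (f : P.L2S) : P.L2S := (P.solution f).2

/-- The misfit functional `J(f) = ½ ‖u_f - g‖²` in `L²(0,T; L²(ω))`. -/
noncomputable def misfit (g f : P.L2S) : ℝ := 1 / 2 * ‖P.observation f - g‖ ^ 2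

end Problem

end Subdiffusion

namespace Subdiffusion

/-- The kernel of the Riemann-Liouville integrals of order `β`, cut off outside `(0,T)`. -/
noncomputable def rlKernel (β T : ℝ) : ℝ → ℝ :=
  (Ioo 0 T).indicator fun r => (Real.Gamma β)⁻¹ * r ^ (β - 1)

section Kernel

variable {β T : ℝ}

lemma rlKernel_nonneg (hβ : 0 < β) (r : ℝ) : 0 ≤ rlKernel β T r := by
  refine indicator_nonneg (fun r hr => ?_) r
  have := Real.Gamma_pos_of_pos hβ
  have := Real.rpow_nonneg hr.1.le (β - 1)
  positivity

lemma measurable_rlKernel : Measurable (rlKernel β T) :=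
  Measurable.indicator (by fun_prop) measurableSet_Ioo

lemma integrable_rlKernel (hβ : 0 < β) (hT : 0 ≤ T) : Integrable (rlKernel β T) := by
  unfold rlKernel
  rw [integrable_indicator_iff measurableSet_Ioo]
  have h := (intervalIntegral.intervalIntegrable_rpow' (a := 0) (b := T)
    (show -1 < β - 1 by linarith)).const_mul (Real.Gamma β)⁻¹
  rw [intervalIntegrable_iff_integrableOn_Ioo_of_le hT] at h
  exact h

lemma leftFracInt_eq (w : ℝ → ℝ) {t : ℝ} (ht : t ∈ Ioo 0 T) :
    leftFracInt β w t = ∫ s in Ioo 0 T, rlKernel β T (t - s) * w s := by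
  rw [leftFracInt, intervalIntegral.integral_of_le ht.1.le, integral_Ioc_eq_integral_Ioo,
    ← integral_const_mul, ← integral_indicator measurableSet_Ioo,
    ← integral_indicator measurableSet_Ioo]
  congr 1
  ext s
  obtain ⟨h0, hT⟩ := ht
  simp only [rlKernel, indicator, mem_Ioo]
  split_ifs with h1 h2 h3 h3 h4
  · ring
  all_goals first | rfl | (exfalso; grind) | simp

lemma rightFracInt_eq (w : ℝ → ℝ) {t : ℝ} (ht : t ∈ Ioo 0 T) :
    rightFracInt β T w t = ∫ s in Ioo 0 T, rlKernel β T (s - t) * w s := by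
  rw [rightFracInt, intervalIntegral.integral_of_le ht.2.le, integral_Ioc_eq_integral_Ioo,
    ← integral_const_mul, ← integral_indicator measurableSet_Ioo,
    ← integral_indicator measurableSet_Ioo]
  congr 1
  ext s
  obtain ⟨h0, hT⟩ := ht
  simp only [rlKernel, indicator, mem_Ioo]
  split_ifs with h1 h2 h3 h3 h4
  · ring
  all_goals first | rfl | (exfalso; grind) | simp

/-- Convolution with an integrable kernel in one variable is bounded on `L¹`. -/
lemma integrable_kernel_mul {A : Type*} [MeasurableSpace A] {m : Measure A} [SFinite m]
    {τ : A → ℝ} (hτ : Measurable τ) {K : ℝ → ℝ} (hK : Integrable K) (hK0 : ∀ r, 0 ≤ K r)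
    {g : A → ℝ} (hg : Integrable g m) (hg0 : ∀ a, 0 ≤ g a) (S : Set ℝ) :
    Integrable (fun q : A × ℝ => K (τ q.1 - q.2) * g q.1) (m.prod (volume.restrict S)) ∧
      ∫ q : A × ℝ, K (τ q.1 - q.2) * g q.1 ∂(m.prod (volume.restrict S))
        ≤ (∫ r, K r) * ∫ a, g a ∂m := by
  have hmp : MeasurePreserving (fun q : A × ℝ => (q.1, τ q.1 - q.2))
      (m.prod volume) (m.prod volume) := by
    refine (MeasurePreserving.id m).skew_product (g := fun a s => τ a - s) ?_ ?_
    · exact (hτ.comp measurable_fst).sub measurable_snd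
    · exact Eventually.of_forall fun a => (Measure.measurePreserving_sub_left volume (τ a)).map_eq
  have hI := hg.mul_prod hK
  have hI' : Integrable (fun q : A × ℝ => K (τ q.1 - q.2) * g q.1) (m.prod volume) := by
    have := hmp.integrable_comp_of_integrable hI
    simpa [Function.comp_def, mul_comm] using this
  have hr : m.prod (volume.restrict S) = (m.prod volume).restrict (univ ×ˢ S) := by
    rw [← Measure.prod_restrict, Measure.restrict_univ]
  rw [hr]
  refine ⟨hI'.restrict, (setIntegral_le_integral hI'
    (Eventually.of_forall fun q => mul_nonneg (hK0 _) (hg0 _))).trans (le_of_eq ?_)⟩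
  have e1 : ∫ q : A × ℝ, K (τ q.1 - q.2) * g q.1 ∂(m.prod volume)
      = ∫ q : A × ℝ, g q.1 * K q.2 ∂(m.prod volume) := by
    conv_rhs => rw [← hmp.map_eq]
    rw [integral_map hmp.measurable.aemeasurable (by rw [hmp.map_eq]; exact hI.aestronglyMeasurable)]
    simp [mul_comm]
  rw [e1, integral_prod_mul, mul_comm]

end Kernel

section Positivity

variable {w w' : ℝ → ℝ} {T : ℝ}

lemma integral_box_mul_deriv_nonpos (hw : ∀ t, HasDerivAt w (w' t) t) (hw' : Continuous w')
    (hT : 0 < T) (hwT : w T = 0) {ρ : ℝ} (hρ : 0 < ρ) :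
    ∫ t in Ioo 0 T, (∫ s in Ioo 0 T, if 0 < t - s ∧ t - s < ρ then w s else 0) * w' t ≤ 0 := by
  have hwc : Continuous w := continuous_iff_continuousAt.2 fun t => (hw t).continuousAt
  set W : ℝ → ℝ := fun t => ∫ s in (0 : ℝ)..t, w s with hW
  have hWd : ∀ t, HasDerivAt W (w t) t := fun t => hwc.integral_hasStrictDerivAt 0 t |>.hasDerivAt
  have hWc : Continuous W := continuous_iff_continuousAt.2 fun t => (hWd t).continuousAt
  have hin : ∀ t ∈ Ioo 0 T, (∫ s in Ioo 0 T, if 0 < t - s ∧ t - s < ρ then w s else 0)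
      = W t - W (max 0 (t - ρ)) := by
    intro t ht
    have hle : max 0 (t - ρ) ≤ t := max_le ht.1.le (by linarith)
    simp only [hW]
    rw [intervalIntegral.integral_interval_sub_left (hwc.intervalIntegrable _ _)
      (hwc.intervalIntegrable _ _), intervalIntegral.integral_of_le hle,
      integral_Ioc_eq_integral_Ioo, ← integral_indicator measurableSet_Ioo,
      ← integral_indicator measurableSet_Ioo]
    congr 1
    ext s
    obtain ⟨h0, hT⟩ := ht
    simp only [indicator, mem_Ioo, max_lt_iff]
    split_ifs with h1 h2 h3 h3 h4
    all_goals first | rfl | (exfalso; grind)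
  rw [setIntegral_congr_fun measurableSet_Ioo
    (g := fun t => W t * w' t - W (max 0 (t - ρ)) * w' t) (fun t ht => by
      simp only [hin t ht]; ring), ← integral_Ioc_eq_integral_Ioo,
    ← intervalIntegral.integral_of_le hT.le]
  have hVc : Continuous fun t => W (max 0 (t - ρ)) * w' t :=
    (hWc.comp (by fun_prop)).mul hw'
  have hWw : Continuous fun t => W t * w' t := hWc.mul hw'
  rw [intervalIntegral.integral_sub (hWw.intervalIntegrable _ _)
    (hVc.intervalIntegrable _ _)]
  have h1 : ∫ t in (0 : ℝ)..T, W t * w' t = -∫ t in (0 : ℝ)..T, w t * w t := by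
    rw [intervalIntegral.integral_mul_deriv_eq_deriv_mul (fun t _ => hWd t) (fun t _ => hw t)
      (hwc.intervalIntegrable _ _) (hw'.intervalIntegrable _ _)]
    simp [hwT, hW]
  set m := min ρ T with hm
  have hm0 : 0 < m := lt_min hρ hT
  have hmT : m ≤ T := min_le_right _ _
  have h2 : ∫ t in (0 : ℝ)..T, W (max 0 (t - ρ)) * w' t = -∫ t in m..T, w (t - m) * w t := by
    rw [← intervalIntegral.integral_add_adjacent_intervals (b := m) (hVc.intervalIntegrable _ _)
      (hVc.intervalIntegrable _ _)]
    have e1 : ∫ t in (0 : ℝ)..m, W (max 0 (t - ρ)) * w' t = 0 := by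
      rw [intervalIntegral.integral_congr (g := fun _ => 0)]
      · simp
      · intro t ht
        rw [uIcc_of_le hm0.le] at ht
        have : t - ρ ≤ 0 := by have := min_le_left ρ T; linarith [ht.2]
        simp [max_eq_left this, hW]
    have e2 : ∫ t in m..T, W (max 0 (t - ρ)) * w' t = ∫ t in m..T, W (t - m) * w' t := by
      refine intervalIntegral.integral_congr fun t ht => ?_
      rw [uIcc_of_le hmT] at ht
      have : max 0 (t - ρ) = t - m := by
        rcases le_total ρ T with h | h
        · rw [hm, min_eq_left h] at ht ⊢
          exact max_eq_right (by linarith [ht.1])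
        · rw [hm, min_eq_right h] at ht ⊢
          rw [le_antisymm ht.2 ht.1, max_eq_left (by linarith), sub_self]
      simp [this]
    have e3 : ∫ t in m..T, W (t - m) * w' t = -∫ t in m..T, w (t - m) * w t := by
      rw [intervalIntegral.integral_mul_deriv_eq_deriv_mul (u := fun t => W (t - m))
        (u' := fun t => w (t - m))
        (fun t _ => by simpa using (hWd (t - m)).comp_sub_const t m) (fun t _ => hw t)
        ((hwc.comp (by fun_prop)).intervalIntegrable _ _) (hw'.intervalIntegrable _ _)]
      simp [hwT, hW]
    rw [e1, e2, e3, zero_add]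
  have hci : ∀ a b, IntervalIntegrable (fun t => w t * w t) volume a b := fun a b =>
    (hwc.mul hwc).intervalIntegrable _ _
  have h3 : ∫ t in m..T, w (t - m) * w t ≤
      ∫ t in m..T, (1 / 2 * (w (t - m) * w (t - m)) + 1 / 2 * (w t * w t)) := by
    refine intervalIntegral.integral_mono_on hmT ?_ ?_ fun t _ => ?_
    · exact (Continuous.mul (by fun_prop) hwc).intervalIntegrable _ _
    · exact Continuous.intervalIntegrable (by fun_prop) _ _
    · nlinarith [sq_nonneg (w (t - m) - w t)]
  have h4 : ∫ t in m..T, (1 / 2 * (w (t - m) * w (t - m)) + 1 / 2 * (w t * w t))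
      = 1 / 2 * (∫ t in (0 : ℝ)..(T - m), w t * w t) + 1 / 2 * ∫ t in m..T, w t * w t := by
    rw [intervalIntegral.integral_add (Continuous.intervalIntegrable (by fun_prop) _ _)
      (Continuous.intervalIntegrable (by fun_prop) _ _), intervalIntegral.integral_const_mul,
      intervalIntegral.integral_const_mul,
      intervalIntegral.integral_comp_sub_right (fun t => w t * w t) m, sub_self]
  have h5 := intervalIntegral.integral_add_adjacent_intervals (hci 0 m) (hci m T)
  have h6 := intervalIntegral.integral_add_adjacent_intervals (hci 0 (T - m)) (hci (T - m) T)
  have h7 : 0 ≤ ∫ t in (0 : ℝ)..m, w t * w t :=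
    intervalIntegral.integral_nonneg hm0.le fun t _ => mul_self_nonneg _
  have h8 : 0 ≤ ∫ t in (T - m)..T, w t * w t :=
    intervalIntegral.integral_nonneg (by linarith) fun t _ => mul_self_nonneg _
  rw [h1, h2]
  linarith

/-- The fractional derivative is positive: `∫ (I^β w) w' ≤ 0` when `w(T) = 0`. -/
lemma integral_rlKernel_mul_deriv_nonpos (hw : ∀ t, HasDerivAt w (w' t) t) (hw' : Continuous w')
    (hT : 0 < T) (hwT : w T = 0) {β : ℝ} (hβ : 0 < β) (hβ1 : β < 1) :
    ∫ t in Ioo 0 T, (∫ s in Ioo 0 T, rlKernel β T (t - s) * w s) * w' t ≤ 0 := by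
  have hwc : Continuous w := continuous_iff_continuousAt.2 fun t => (hw t).continuousAt
  set ν : Measure ℝ := volume.restrict (Ioo 0 T) with hν
  obtain ⟨C, hC⟩ := (isCompact_Icc (a := 0) (b := T)).exists_bound_of_continuousOn hwc.continuousOn
  obtain ⟨C', hC'⟩ := (isCompact_Icc (a := 0) (b := T)).exists_bound_of_continuousOn
    hw'.continuousOn
  have haem : ∀ᵐ p : ℝ × ℝ ∂(ν.prod ν), p ∈ Ioo 0 T ×ˢ Ioo 0 T := by
    rw [hν, Measure.prod_restrict]
    exact ae_restrict_mem (measurableSet_Ioo.prod measurableSet_Ioo)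
  have hbd : ∀ᵐ p : ℝ × ℝ ∂(ν.prod ν), ‖w p.2 * w' p.1‖ ≤ C * C' := by
    filter_upwards [haem] with p hp
    rw [norm_mul]
    have h2 := hC p.2 (Ioo_subset_Icc_self hp.2)
    exact mul_le_mul h2 (hC' p.1 (Ioo_subset_Icc_self hp.1)) (norm_nonneg _)
      ((norm_nonneg _).trans h2)
  have hwwc : Continuous fun p : ℝ × ℝ => w p.2 * w' p.1 := by fun_prop
  have hKint : Integrable (fun p : ℝ × ℝ => rlKernel β T (p.1 - p.2)) (ν.prod ν) := by
    have := (integrable_kernel_mul (m := ν) (τ := id) measurable_id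
      (integrable_rlKernel hβ hT.le) (rlKernel_nonneg hβ) (integrable_const (1 : ℝ))
      (fun _ => zero_le_one) (Ioo 0 T)).1
    simpa using this
  have hKww : Integrable (fun p : ℝ × ℝ => rlKernel β T (p.1 - p.2) * (w p.2 * w' p.1))
      (ν.prod ν) := hKint.mul_bdd hwwc.aestronglyMeasurable hbd
  set b : ℝ → ℝ → ℝ := fun r ρ => if 0 < r ∧ r < ρ then ρ ^ (β - 2) else 0 with hb
  have hbm : Measurable fun z : ℝ × ℝ => b z.1 z.2 := by
    refine Measurable.ite ?_ (by fun_prop) measurable_const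
    exact (measurableSet_lt measurable_const measurable_fst).inter
      (measurableSet_lt measurable_fst measurable_snd)
  have hbind : ∀ r, 0 < r → (fun ρ => b r ρ) = (Ioi r).indicator fun ρ => ρ ^ (β - 2) := by
    intro r hr
    ext ρ
    simp [hb, indicator, hr]
  have hbint : ∀ r, 0 < r → ∫ ρ in Ioi 0, b r ρ = (1 - β)⁻¹ * r ^ (β - 1) := by
    intro r hr
    rw [hbind r hr, setIntegral_indicator measurableSet_Ioi,
      inter_eq_right.2 (Ioi_subset_Ioi hr.le), integral_Ioi_rpow_of_lt (by linarith) hr,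
      show β - 2 + 1 = β - 1 by ring]
    have : (1 - β) ≠ 0 := by linarith
    have : (β - 1) ≠ 0 := by linarith
    field_simp
    ring
  have hbi : ∀ r, Integrable (fun ρ => b r ρ) (volume.restrict (Ioi 0)) := by
    intro r
    rcases le_or_gt r 0 with h | h
    · have : (fun ρ => b r ρ) = fun _ => 0 := by
        ext ρ; simp only [hb]; rw [if_neg]; grind
      rw [this]; exact integrable_zero _ _ _
    · rw [hbind r h]
      refine Integrable.restrict ?_
      rw [integrable_indicator_iff measurableSet_Ioi]
      exact integrableOn_Ioi_rpow_of_lt (by linarith) h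
  have hb0 : ∀ r ρ, 0 ≤ ρ → 0 ≤ b r ρ := by
    intro r ρ h
    simp only [hb]
    split_ifs
    · exact Real.rpow_nonneg h _
    · exact le_rfl
  have hG := Real.Gamma_pos_of_pos hβ
  have hbK : ∀ p : ℝ × ℝ, p ∈ Ioo 0 T ×ˢ Ioo 0 T →
      ∫ ρ in Ioi 0, b (p.1 - p.2) ρ = (1 - β)⁻¹ * Real.Gamma β * rlKernel β T (p.1 - p.2) := by
    rintro ⟨t, s⟩ ⟨⟨h1, h2⟩, h3, h4⟩
    simp only at h1 h2 h3 h4 ⊢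
    rcases le_or_gt (t - s) 0 with h | h
    · have : (fun ρ => b (t - s) ρ) = fun _ => 0 := by
        ext ρ; simp only [hb]; rw [if_neg]; grind
      rw [this, rlKernel, indicator_of_notMem (by grind)]
      simp
    · rw [hbint _ h, rlKernel, indicator_of_mem (by grind)]
      field_simp
  have hF : Integrable (fun z : (ℝ × ℝ) × ℝ => b (z.1.1 - z.1.2) z.2 * (w z.1.2 * w' z.1.1))
      ((ν.prod ν).prod (volume.restrict (Ioi 0))) := by
    have hmeas : AEStronglyMeasurable
        (fun z : (ℝ × ℝ) × ℝ => b (z.1.1 - z.1.2) z.2 * (w z.1.2 * w' z.1.1))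
        ((ν.prod ν).prod (volume.restrict (Ioi 0))) := by
      refine AEStronglyMeasurable.mul ?_ (Continuous.aestronglyMeasurable (by fun_prop))
      exact (hbm.comp (f := fun z : (ℝ × ℝ) × ℝ => (z.1.1 - z.1.2, z.2))
        (by fun_prop)).aestronglyMeasurable
    rw [integrable_prod_iff hmeas]
    refine ⟨Eventually.of_forall fun p => (hbi (p.1 - p.2)).mul_const (w p.2 * w' p.1), ?_⟩
    refine ((hKww.norm).const_mul ((1 - β)⁻¹ * Real.Gamma β)).congr ?_
    filter_upwards [haem] with p hp
    have : ∀ ρ ∈ Ioi (0 : ℝ), ‖b (p.1 - p.2) ρ * (w p.2 * w' p.1)‖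
        = b (p.1 - p.2) ρ * ‖w p.2 * w' p.1‖ := by
      intro ρ hρ
      rw [norm_mul, Real.norm_of_nonneg (hb0 _ _ (le_of_lt hρ))]
    rw [setIntegral_congr_fun measurableSet_Ioi this, integral_mul_const, hbK p hp, norm_mul,
      Real.norm_of_nonneg (rlKernel_nonneg hβ _)]
    ring
  have hbox : ∀ ρ, 0 < ρ →
      ∫ p, b (p.1 - p.2) ρ * (w p.2 * w' p.1) ∂(ν.prod ν) ≤ 0 := by
    intro ρ hρ
    have hbi' : Integrable (fun p : ℝ × ℝ => b (p.1 - p.2) ρ * (w p.2 * w' p.1)) (ν.prod ν) := by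
      have h1 : Integrable (fun p : ℝ × ℝ => w p.2 * w' p.1) (ν.prod ν) :=
        Integrable.of_bound hwwc.aestronglyMeasurable _ hbd
      refine h1.bdd_mul (c := ρ ^ (β - 2)) ?_ ?_
      · exact (hbm.comp (f := fun p : ℝ × ℝ => (p.1 - p.2, ρ)) (by fun_prop)).aestronglyMeasurable
      · refine Eventually.of_forall fun p => ?_
        have := Real.rpow_nonneg hρ.le (β - 2)
        rw [Real.norm_of_nonneg (hb0 _ _ hρ.le)]
        simp only [hb]
        split_ifs <;> linarith
    rw [integral_prod _ hbi']
    have := integral_box_mul_deriv_nonpos hw hw' hT hwT hρ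
    have e : (∫ t, ∫ s, b (t - s) ρ * (w s * w' t) ∂ν ∂ν) = ρ ^ (β - 2) *
        ∫ t, (∫ s, (if 0 < t - s ∧ t - s < ρ then w s else 0) ∂ν) * w' t ∂ν := by
      rw [← integral_const_mul]
      congr 1; ext t
      rw [← integral_mul_const, ← integral_const_mul]
      congr 1; ext s
      simp only [hb]
      split_ifs <;> ring
    simp only at e ⊢
    rw [e]
    exact mul_nonpos_of_nonneg_of_nonpos (Real.rpow_nonneg hρ.le _) this
  have hswap := integral_integral_swap (f := fun (p : ℝ × ℝ) ρ =>
    b (p.1 - p.2) ρ * (w p.2 * w' p.1)) hF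
  have hL : ∫ p, (∫ ρ in Ioi 0, b (p.1 - p.2) ρ * (w p.2 * w' p.1)) ∂(ν.prod ν)
      = (1 - β)⁻¹ * Real.Gamma β *
        ∫ t, (∫ s, rlKernel β T (t - s) * w s ∂ν) * w' t ∂ν := by
    have e1 : ∫ p, (∫ ρ in Ioi 0, b (p.1 - p.2) ρ * (w p.2 * w' p.1)) ∂(ν.prod ν)
        = ∫ p, (1 - β)⁻¹ * Real.Gamma β * (rlKernel β T (p.1 - p.2) * (w p.2 * w' p.1))
          ∂(ν.prod ν) := by
      refine integral_congr_ae ?_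
      filter_upwards [haem] with p hp
      rw [integral_mul_const, hbK p hp]
      ring
    rw [e1, integral_const_mul, integral_prod _ hKww]
    congr 2; ext t
    rw [← integral_mul_const]
    simp [mul_assoc]
  have hR : ∫ ρ in Ioi 0, ∫ p, b (p.1 - p.2) ρ * (w p.2 * w' p.1) ∂(ν.prod ν) ≤ 0 :=
    setIntegral_nonpos measurableSet_Ioi fun ρ hρ => hbox ρ hρ
  rw [← hswap, hL] at hR
  by_contra! hcon
  have : 0 < (1 - β)⁻¹ * Real.Gamma β := mul_pos (inv_pos.2 (by linarith)) hG
  linarith [mul_pos this hcon]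

/-- The reflected form of `integral_rlKernel_mul_deriv_nonpos`. -/
lemma integral_rlKernel_mul_deriv_nonneg (hw : ∀ t, HasDerivAt w (w' t) t) (hw' : Continuous w')
    (hT : 0 < T) (hw0 : w 0 = 0) {β : ℝ} (hβ : 0 < β) (hβ1 : β < 1) :
    0 ≤ ∫ t in Ioo 0 T, (∫ s in Ioo 0 T, rlKernel β T (s - t) * w s) * w' t := by
  have key := integral_rlKernel_mul_deriv_nonpos (w := fun t => w (T - t))
    (w' := fun t => -w' (T - t)) (T := T) (fun t => by
      simpa using (hw (T - t)).comp_const_sub T t) (by fun_prop) hT (by simpa) hβ hβ1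
  have hrefl : ∀ f : ℝ → ℝ, ∫ t in Ioo 0 T, f (T - t) = ∫ t in Ioo 0 T, f t := by
    intro f
    rw [← integral_Ioc_eq_integral_Ioo, ← intervalIntegral.integral_of_le hT.le,
      ← integral_Ioc_eq_integral_Ioo, ← intervalIntegral.integral_of_le hT.le,
      intervalIntegral.integral_comp_sub_left f T]
    simp
  have e : ∀ t, ∫ s in Ioo 0 T, rlKernel β T (t - s) * w (T - s)
      = ∫ s in Ioo 0 T, rlKernel β T (s - (T - t)) * w s := by
    intro t
    rw [← hrefl fun s => rlKernel β T (s - (T - t)) * w s]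
    simp
  simp only [e] at key
  rw [hrefl fun t => (∫ s in Ioo 0 T, rlKernel β T (s - t) * w s) * (-w' t)] at key
  simp only [mul_neg, integral_neg] at key
  linarith

end Positivity

section FracPairing

variable {X : Type*} [MeasurableSpace X] {μ : Measure X} {β T : ℝ}

/-- Exchange of the last two components in `((x, t), s)`. -/
def swapRight (q : (X × ℝ) × ℝ) : (X × ℝ) × ℝ := ((q.1.1, q.2), q.1.2)

variable (β T μ) in
/-- The pairing `∫ (I^β w) z = ∫∫∫ K(t - s) w(x,s) z(x,t)`. -/
noncomputable def fracInt (w z : X × ℝ → ℝ) : ℝ :=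
  ∫ q : (X × ℝ) × ℝ, rlKernel β T (q.1.2 - q.2) * w (q.1.1, q.2) * z q.1
    ∂((μ.prod (volume.restrict (Ioo 0 T))).prod (volume.restrict (Ioo 0 T)))

variable {w z w₁ w₂ z₁ z₂ : X × ℝ → ℝ}

local notation "νT" => (volume.restrict (Ioo 0 T) : Measure ℝ)

lemma fracInt_smul_left (c : ℝ) : fracInt μ β T (c • w) z = c * fracInt μ β T w z := by
  rw [fracInt, fracInt, ← integral_const_mul]
  congr 1; ext q; simp only [Pi.smul_apply, smul_eq_mul]; ring

lemma fracInt_smul_right (c : ℝ) : fracInt μ β T w (c • z) = c * fracInt μ β T w z := by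
  rw [fracInt, fracInt, ← integral_const_mul]
  congr 1; ext q; simp only [Pi.smul_apply, smul_eq_mul]; ring

lemma ae_snd_mem_Ioo : ∀ᵐ p ∂(μ.prod νT), p.2 ∈ Ioo 0 T :=
  Measure.quasiMeasurePreserving_snd.ae (ae_restrict_mem measurableSet_Ioo)

variable [SFinite μ]

lemma measurePreserving_swapRight (ν₁ ν₂ : Measure ℝ) [SFinite ν₁] [SFinite ν₂] :
    MeasurePreserving (swapRight (X := X)) ((μ.prod ν₁).prod ν₂) ((μ.prod ν₂).prod ν₁) := by
  have h1 := measurePreserving_prodAssoc μ ν₁ ν₂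
  have h2 : MeasurePreserving (Prod.map id Prod.swap : X × (ℝ × ℝ) → X × (ℝ × ℝ))
      (μ.prod (ν₁.prod ν₂)) (μ.prod (ν₂.prod ν₁)) :=
    (MeasurePreserving.id μ).prod Measure.measurePreserving_swap
  exact ((measurePreserving_prodAssoc μ ν₂ ν₁).symm _).comp (h2.comp h1)

lemma aestronglyMeasurable_fracInt (hw : AEStronglyMeasurable w (μ.prod νT))
    (hz : AEStronglyMeasurable z (μ.prod νT)) :
    AEStronglyMeasurable (fun q : (X × ℝ) × ℝ =>
      rlKernel β T (q.1.2 - q.2) * w (q.1.1, q.2) * z q.1) ((μ.prod νT).prod νT) := by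
  refine AEStronglyMeasurable.mul (AEStronglyMeasurable.mul ?_ ?_) ?_
  · exact (measurable_rlKernel.comp (by fun_prop)).aestronglyMeasurable
  · exact (hw.comp_fst (ν := νT)).comp_measurePreserving (measurePreserving_swapRight νT νT)
  · exact hz.comp_fst

lemma fracInt_integrable_aux (hβ : 0 < β) (hT : 0 ≤ T) (hw : MemLp w 2 (μ.prod νT))
    (hz : MemLp z 2 (μ.prod νT)) :
    Integrable (fun q : (X × ℝ) × ℝ => rlKernel β T (q.1.2 - q.2) * w (q.1.1, q.2) * z q.1)
      ((μ.prod νT).prod νT) ∧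
    ‖fracInt μ β T w z‖ ≤ (∫ r, rlKernel β T r) *
      (1 / 2 * (∫ p, w p ^ 2 ∂(μ.prod νT)) + 1 / 2 * ∫ p, z p ^ 2 ∂(μ.prod νT)) := by
  have hK := integrable_rlKernel hβ hT
  have hK0 := rlKernel_nonneg (T := T) hβ
  obtain ⟨h1, b1⟩ := integrable_kernel_mul (m := μ.prod νT) (τ := Prod.snd) measurable_snd hK hK0
    hz.integrable_sq (fun _ => sq_nonneg _) (Ioo 0 T)
  obtain ⟨h2, b2⟩ := integrable_kernel_mul (m := μ.prod νT) (τ := Prod.snd) measurable_snd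
    hK.comp_neg (fun r => hK0 (-r)) hw.integrable_sq (fun _ => sq_nonneg _) (Ioo 0 T)
  have hmp := measurePreserving_swapRight (μ := μ) νT νT
  have h2' : Integrable (fun q : (X × ℝ) × ℝ => rlKernel β T (q.1.2 - q.2) * w (q.1.1, q.2) ^ 2)
      ((μ.prod νT).prod νT) := by
    simpa [swapRight, Function.comp_def] using hmp.integrable_comp_of_integrable h2
  have b2' : ∫ q : (X × ℝ) × ℝ, rlKernel β T (q.1.2 - q.2) * w (q.1.1, q.2) ^ 2
      ∂((μ.prod νT).prod νT) ≤ (∫ r, rlKernel β T r) * ∫ p, w p ^ 2 ∂(μ.prod νT) := by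
    rw [← integral_neg_eq_self (rlKernel β T) volume]
    refine le_trans (le_of_eq ?_) b2
    conv_rhs => rw [← hmp.map_eq]
    rw [integral_map hmp.measurable.aemeasurable (by
      rw [hmp.map_eq]; exact h2.aestronglyMeasurable)]
    simp [swapRight]
  have hsum := (h2'.const_mul (1 / 2)).add (h1.const_mul (1 / 2))
  have hle : ∀ q : (X × ℝ) × ℝ, ‖rlKernel β T (q.1.2 - q.2) * w (q.1.1, q.2) * z q.1‖ ≤
      1 / 2 * (rlKernel β T (q.1.2 - q.2) * w (q.1.1, q.2) ^ 2)
        + 1 / 2 * (rlKernel β T (q.1.2 - q.2) * z q.1 ^ 2) := by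
    intro q
    rw [mul_assoc, norm_mul, Real.norm_of_nonneg (hK0 _)]
    have : ‖w (q.1.1, q.2) * z q.1‖ ≤ 1 / 2 * w (q.1.1, q.2) ^ 2 + 1 / 2 * z q.1 ^ 2 := by
      rw [Real.norm_eq_abs, abs_le]
      constructor <;> nlinarith [sq_nonneg (w (q.1.1, q.2) - z q.1),
        sq_nonneg (w (q.1.1, q.2) + z q.1)]
    nlinarith [mul_le_mul_of_nonneg_left this (hK0 (q.1.2 - q.2))]
  refine ⟨hsum.mono' (aestronglyMeasurable_fracInt hw.1 hz.1) (Eventually.of_forall hle), ?_⟩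
  refine (norm_integral_le_of_norm_le hsum (Eventually.of_forall hle)).trans ?_
  have := integral_add (h2'.const_mul (1 / 2)) (h1.const_mul (1 / 2))
  simp only [Pi.add_apply] at this ⊢
  rw [this, integral_const_mul, integral_const_mul]
  linarith

lemma fracInt_integrable (hβ : 0 < β) (hT : 0 ≤ T) (hw : MemLp w 2 (μ.prod νT))
    (hz : MemLp z 2 (μ.prod νT)) :
    Integrable (fun q : (X × ℝ) × ℝ => rlKernel β T (q.1.2 - q.2) * w (q.1.1, q.2) * z q.1)
      ((μ.prod νT).prod νT) :=
  (fracInt_integrable_aux hβ hT hw hz).1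

lemma fracInt_congr (hw : w₁ =ᵐ[μ.prod νT] w₂) (hz : z₁ =ᵐ[μ.prod νT] z₂) :
    fracInt μ β T w₁ z₁ = fracInt μ β T w₂ z₂ := by
  refine integral_congr_ae ?_
  have h1 : ∀ᵐ q ∂((μ.prod νT).prod νT), z₁ q.1 = z₂ q.1 :=
    Measure.quasiMeasurePreserving_fst.ae hz
  have h2 : ∀ᵐ q ∂((μ.prod νT).prod νT), w₁ (q.1.1, q.2) = w₂ (q.1.1, q.2) :=
    (Measure.quasiMeasurePreserving_fst.comp
      (measurePreserving_swapRight νT νT).quasiMeasurePreserving).ae hw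
  filter_upwards [h1, h2] with q h1 h2
  rw [h1, h2]

lemma fracInt_add_left (hβ : 0 < β) (hT : 0 ≤ T) (hw₁ : MemLp w₁ 2 (μ.prod νT))
    (hw₂ : MemLp w₂ 2 (μ.prod νT)) (hz : MemLp z 2 (μ.prod νT)) :
    fracInt μ β T (w₁ + w₂) z = fracInt μ β T w₁ z + fracInt μ β T w₂ z := by
  rw [fracInt, fracInt, fracInt, ← integral_add (fracInt_integrable hβ hT hw₁ hz)
    (fracInt_integrable hβ hT hw₂ hz)]
  congr 1; ext q; simp only [Pi.add_apply]; ring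

lemma fracInt_add_right (hβ : 0 < β) (hT : 0 ≤ T) (hw : MemLp w 2 (μ.prod νT))
    (hz₁ : MemLp z₁ 2 (μ.prod νT)) (hz₂ : MemLp z₂ 2 (μ.prod νT)) :
    fracInt μ β T w (z₁ + z₂) = fracInt μ β T w z₁ + fracInt μ β T w z₂ := by
  rw [fracInt, fracInt, fracInt, ← integral_add (fracInt_integrable hβ hT hw hz₁)
    (fracInt_integrable hβ hT hw hz₂)]
  congr 1; ext q; simp only [Pi.add_apply]; ring

lemma integral_sq_eq_norm_sq {A : Type*} [MeasurableSpace A] {m : Measure A} (w : Lp ℝ 2 m) :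
    ∫ p, w p ^ 2 ∂m = ‖w‖ ^ 2 := by
  rw [← real_inner_self_eq_norm_sq, L2.inner_def]
  simp [sq]

lemma norm_fracInt_le (hβ : 0 < β) (hT : 0 ≤ T) (w z : Lp ℝ 2 (μ.prod νT)) :
    ‖fracInt μ β T w z‖ ≤ (∫ r, rlKernel β T r) * ‖w‖ * ‖z‖ := by
  have hgen : ∀ w z : Lp ℝ 2 (μ.prod νT), ‖fracInt μ β T w z‖ ≤
      (∫ r, rlKernel β T r) * (1 / 2 * ‖w‖ ^ 2 + 1 / 2 * ‖z‖ ^ 2) := by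
    intro w z
    have := (fracInt_integrable_aux (μ := μ) hβ hT (Lp.memLp w) (Lp.memLp z)).2
    rwa [integral_sq_eq_norm_sq, integral_sq_eq_norm_sq] at this
  have hsm : ∀ (a b : ℝ) (w z : Lp ℝ 2 (μ.prod νT)),
      fracInt μ β T (a • w : Lp ℝ 2 (μ.prod νT)) (b • z : Lp ℝ 2 (μ.prod νT))
        = a * (b * fracInt μ β T w z) := by
    intro a b w z
    rw [fracInt_congr (Lp.coeFn_smul a w) (Lp.coeFn_smul b z), fracInt_smul_left,
      fracInt_smul_right]
  rcases eq_or_ne w 0 with rfl | hw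
  · have := hsm 0 1 0 z
    simp only [zero_smul, one_smul, zero_mul] at this
    rw [this]; simp
  rcases eq_or_ne z 0 with rfl | hz
  · have := hsm 1 0 w 0
    simp only [zero_smul, one_smul, zero_mul, mul_zero] at this
    rw [this]; simp
  have hw' := norm_pos_iff.2 hw
  have hz' := norm_pos_iff.2 hz
  have := hgen (‖w‖⁻¹ • w) (‖z‖⁻¹ • z)
  rw [hsm, norm_smul, norm_smul, norm_mul, norm_mul] at this
  simp only [norm_inv, norm_norm] at this
  rw [inv_mul_cancel₀ hw'.ne', inv_mul_cancel₀ hz'.ne'] at this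
  calc ‖fracInt μ β T w z‖ = (‖w‖⁻¹ * (‖z‖⁻¹ * ‖fracInt μ β T w z‖)) * (‖w‖ * ‖z‖) := by
        field_simp
    _ ≤ ((∫ r, rlKernel β T r) * (1 / 2 * 1 ^ 2 + 1 / 2 * 1 ^ 2)) * (‖w‖ * ‖z‖) := by
        gcongr
    _ = _ := by ring

/-- `fracInt` as a bounded bilinear form on `L²`. -/
noncomputable def fracForm {m : Measure (X × ℝ)} (hm : m = μ.prod νT) (hβ : 0 < β) (hT : 0 ≤ T) :
    Lp ℝ 2 m →L[ℝ] Lp ℝ 2 m →L[ℝ] ℝ :=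
  LinearMap.mkContinuous₂
    (LinearMap.mk₂ ℝ (fun w z : Lp ℝ 2 m => fracInt μ β T w z)
      (fun w₁ w₂ z => by
        subst hm
        rw [fracInt_congr (Lp.coeFn_add w₁ w₂) (ae_eq_refl _),
          fracInt_add_left hβ hT (Lp.memLp _) (Lp.memLp _) (Lp.memLp _)])
      (fun c w z => by
        subst hm
        rw [fracInt_congr (Lp.coeFn_smul c w) (ae_eq_refl _), fracInt_smul_left, smul_eq_mul])
      (fun w z₁ z₂ => by
        subst hm
        rw [fracInt_congr (ae_eq_refl _) (Lp.coeFn_add z₁ z₂),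
          fracInt_add_right hβ hT (Lp.memLp _) (Lp.memLp _) (Lp.memLp _)])
      (fun c w z => by
        subst hm
        rw [fracInt_congr (ae_eq_refl _) (Lp.coeFn_smul c z), fracInt_smul_right, smul_eq_mul]))
    (∫ r, rlKernel β T r) (by subst hm; exact norm_fracInt_le hβ hT)

lemma fracInt_eq_integral_left (hβ : 0 < β) (hT : 0 ≤ T) (hw : MemLp w 2 (μ.prod νT))
    (hz : MemLp z 2 (μ.prod νT)) :
    fracInt μ β T w z
      = ∫ p, (∫ s in Ioo 0 T, rlKernel β T (p.2 - s) * w (p.1, s)) * z p ∂(μ.prod νT) := by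
  rw [fracInt, integral_prod _ (fracInt_integrable hβ hT hw hz)]
  simp only [integral_mul_const]

lemma fracInt_eq_integral_right (hβ : 0 < β) (hT : 0 ≤ T) (hw : MemLp w 2 (μ.prod νT))
    (hz : MemLp z 2 (μ.prod νT)) :
    fracInt μ β T w z
      = ∫ p, (∫ s in Ioo 0 T, rlKernel β T (s - p.2) * z (p.1, s)) * w p ∂(μ.prod νT) := by
  have hmp := measurePreserving_swapRight (μ := μ) νT νT
  have hI := fracInt_integrable hβ hT hw hz
  have e : fracInt μ β T w z = ∫ q : (X × ℝ) × ℝ,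
      rlKernel β T (q.2 - q.1.2) * w q.1 * z (q.1.1, q.2) ∂((μ.prod νT).prod νT) := by
    rw [fracInt]
    conv_lhs => rw [← hmp.map_eq]
    rw [integral_map hmp.measurable.aemeasurable (by
      rw [hmp.map_eq]; exact hI.aestronglyMeasurable)]
    simp [swapRight]
  rw [e, integral_prod]
  · congr 1; ext p
    rw [← integral_mul_const]
    congr 1; ext s; ring
  · simpa [swapRight, Function.comp_def] using hmp.integrable_comp_of_integrable hI

lemma integral_leftFracInt_mul (hβ : 0 < β) (hT : 0 ≤ T) (hw : MemLp w 2 (μ.prod νT))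
    (hz : MemLp z 2 (μ.prod νT)) :
    ∫ p, leftFracInt β (fun s => w (p.1, s)) p.2 * z p ∂(μ.prod νT) = fracInt μ β T w z := by
  rw [fracInt_eq_integral_left hβ hT hw hz]
  refine integral_congr_ae ?_
  filter_upwards [ae_snd_mem_Ioo] with p hp
  rw [leftFracInt_eq _ hp]

lemma integral_rightFracInt_mul (hβ : 0 < β) (hT : 0 ≤ T) (hw : MemLp w 2 (μ.prod νT))
    (hz : MemLp z 2 (μ.prod νT)) :
    ∫ p, rightFracInt β T (fun s => z (p.1, s)) p.2 * w p ∂(μ.prod νT) = fracInt μ β T w z := by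
  rw [fracInt_eq_integral_right hβ hT hw hz]
  refine integral_congr_ae ?_
  filter_upwards [ae_snd_mem_Ioo] with p hp
  rw [rightFracInt_eq _ hp]

lemma integrable_fracInt_left (hβ : 0 < β) (hT : 0 ≤ T) (hw : MemLp w 2 (μ.prod νT))
    (hz : MemLp z 2 (μ.prod νT)) :
    Integrable (fun p => (∫ s in Ioo 0 T, rlKernel β T (p.2 - s) * w (p.1, s)) * z p)
      (μ.prod νT) := by
  simpa only [integral_mul_const] using (fracInt_integrable hβ hT hw hz).integral_prod_left

lemma integrable_fracInt_right (hβ : 0 < β) (hT : 0 ≤ T) (hw : MemLp w 2 (μ.prod νT))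
    (hz : MemLp z 2 (μ.prod νT)) :
    Integrable (fun p => (∫ s in Ioo 0 T, rlKernel β T (s - p.2) * z (p.1, s)) * w p)
      (μ.prod νT) := by
  have h := ((measurePreserving_swapRight (μ := μ) νT νT).integrable_comp_of_integrable
    (fracInt_integrable hβ hT hw hz)).integral_prod_left
  refine h.congr (Eventually.of_forall fun p => ?_)
  simp only [swapRight, Function.comp_def]
  rw [← integral_mul_const]
  congr 1; ext s; ring

/-- Time translation may be moved from one factor of `fracInt` to the other. -/
lemma fracInt_translate (hβ : 0 < β) (hT : 0 ≤ T) {h : ℝ} (hh : 0 ≤ h)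
    (hw : MemLp w 2 (μ.prod νT)) (hz : MemLp z 2 (μ.prod νT))
    (hwh : MemLp (fun p : X × ℝ => w (p.1, p.2 - h)) 2 (μ.prod νT))
    (hzh : MemLp (fun p : X × ℝ => z (p.1, p.2 + h)) 2 (μ.prod νT))
    (hw0 : ∀ p, p.2 ∉ Ioo 0 T → w p = 0) (hz0 : ∀ p, p.2 ∉ Ioo 0 T → z p = 0) :
    fracInt μ β T w (fun p => z (p.1, p.2 + h)) = fracInt μ β T (fun p => w (p.1, p.2 - h)) z := by
  rw [fracInt_eq_integral_left hβ hT hw hzh, fracInt_eq_integral_left hβ hT hwh hz,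
    integral_prod _ (integrable_fracInt_left hβ hT hw hzh),
    integral_prod _ (integrable_fracInt_left hβ hT hwh hz)]
  congr 1; ext x
  simp only
  have hK0 : ∀ r ≤ 0, rlKernel β T r = 0 := fun r hr =>
    indicator_of_notMem (fun h => absurd h.1 (not_lt.2 hr)) _
  have a1 : ∀ t, ∫ s in Ioo 0 T, rlKernel β T (t - s) * w (x, s)
      = ∫ s, rlKernel β T (t - s) * w (x, s) := fun t =>
    setIntegral_eq_integral_of_forall_compl_eq_zero fun s hs => by rw [hw0 _ hs, mul_zero]
  have a2 : ∫ t in Ioo 0 T, (∫ s, rlKernel β T (t - s) * w (x, s)) * z (x, t + h)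
      = ∫ t, (∫ s, rlKernel β T (t - s) * w (x, s)) * z (x, t + h) := by
    refine setIntegral_eq_integral_of_forall_compl_eq_zero fun t ht => ?_
    rcases le_or_gt t 0 with h0 | h0
    · rw [← a1, setIntegral_eq_zero_of_forall_eq_zero, zero_mul]
      intro s hs
      rw [hK0 _ (by linarith [hs.1]), zero_mul]
    · rw [hz0, mul_zero]
      intro h'
      exact ht ⟨h0, by linarith [h'.2]⟩
  have b1 : ∀ t ∈ Ioo 0 T, ∫ s in Ioo 0 T, rlKernel β T (t - s) * w (x, s - h)
      = ∫ s, rlKernel β T (t - s) * w (x, s - h) := by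
    intro t ht
    refine setIntegral_eq_integral_of_forall_compl_eq_zero fun s hs => ?_
    rcases le_or_gt s 0 with h0 | h0
    · rw [hw0, mul_zero]
      intro h'
      linarith [h'.1]
    · rw [hK0, zero_mul]
      have : T ≤ s := by by_contra! hc; exact hs ⟨h0, hc⟩
      linarith [ht.2]
  have b2 : ∫ t in Ioo 0 T, (∫ s, rlKernel β T (t - s) * w (x, s - h)) * z (x, t)
      = ∫ t, (∫ s, rlKernel β T (t - s) * w (x, s - h)) * z (x, t) :=
    setIntegral_eq_integral_of_forall_compl_eq_zero fun t ht => by rw [hz0 _ ht, mul_zero]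
  simp only [a1]
  rw [a2, setIntegral_congr_fun measurableSet_Ioo (g := fun t =>
    (∫ s, rlKernel β T (t - s) * w (x, s - h)) * z (x, t))
    (fun t ht => by simp only [b1 t ht]), b2,
    ← integral_sub_right_eq_self (fun t => (∫ s, rlKernel β T (t - s) * w (x, s)) * z (x, t + h)) h]
  congr 1; ext t
  rw [← integral_sub_right_eq_self (fun s => rlKernel β T (t - h - s) * w (x, s)) h]
  simp

lemma fracInt_deriv_nonpos (hβ : 0 < β) (hβ1 : β < 1) (hT : 0 < T) (hw : MemLp w 2 (μ.prod νT))
    (hz : MemLp z 2 (μ.prod νT)) (hd : ∀ x t, HasDerivAt (fun t => w (x, t)) (z (x, t)) t)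
    (hc : ∀ x, Continuous fun t => z (x, t)) (h0 : ∀ x, w (x, T) = 0) :
    fracInt μ β T w z ≤ 0 := by
  rw [fracInt_eq_integral_left hβ hT.le hw hz,
    integral_prod _ (integrable_fracInt_left hβ hT.le hw hz)]
  exact integral_nonpos fun x =>
    integral_rlKernel_mul_deriv_nonpos (hd x) (hc x) hT (h0 x) hβ hβ1

lemma fracInt_deriv_nonneg (hβ : 0 < β) (hβ1 : β < 1) (hT : 0 < T) (hw : MemLp w 2 (μ.prod νT))
    (hz : MemLp z 2 (μ.prod νT)) (hd : ∀ x t, HasDerivAt (fun t => w (x, t)) (z (x, t)) t)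
    (hc : ∀ x, Continuous fun t => z (x, t)) (h0 : ∀ x, w (x, 0) = 0) :
    0 ≤ fracInt μ β T z w := by
  rw [fracInt_eq_integral_right hβ hT.le hz hw,
    integral_prod _ (integrable_fracInt_right hβ hT.le hz hw)]
  exact integral_nonneg fun x =>
    integral_rlKernel_mul_deriv_nonneg (hd x) (hc x) hT (h0 x) hβ hβ1

end FracPairing

section HilbertSpace

variable {V : Type*} [NormedAddCommGroup V] [InnerProductSpace ℝ V]

variable (V) in
/-- The real inner product as a bounded bilinear form. -/
noncomputable def innerBilin : V →L[ℝ] V →L[ℝ] ℝ :=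
  LinearMap.mkContinuous₂ (innerₗ V) 1 fun x y => by
    simpa using norm_inner_le_norm (𝕜 := ℝ) x y

lemma innerBilin_apply (x y : V) : innerBilin V x y = inner ℝ x y := rfl

/-- Lions' theorem: a family of functionals that is coercive on a dense set of test vectors can be
prescribed there. -/
lemma exists_forall_eq_of_coercive [CompleteSpace V] {M : Type*} [AddCommGroup M] [Module ℝ M]
    (J : M →ₗ[ℝ] V) (K : M →ₗ[ℝ] V →L[ℝ] ℝ) {c : ℝ} (hc : 0 < c)
    (hK : ∀ m, c * ‖J m‖ ^ 2 ≤ K m (J m)) (L : V →L[ℝ] ℝ) : ∃ x, ∀ m, K m x = L (J m) := by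
  let k : M →ₗ[ℝ] V :=
    { toFun := fun m => (InnerProductSpace.toDual ℝ V).symm (K m)
      map_add' := fun a b => by simp
      map_smul' := fun a b => by simp }
  have hk : ∀ m y, inner ℝ (k m) y = K m y := fun m y =>
    InnerProductSpace.toDual_symm_apply
  have hJk : ∀ m, c * ‖J m‖ ≤ ‖k m‖ := by
    intro m
    rcases eq_or_ne (J m) 0 with h | h
    · simp [h]
    · have h1 : c * ‖J m‖ ^ 2 ≤ ‖k m‖ * ‖J m‖ := by
        refine (hK m).trans ?_
        rw [← hk]
        exact real_inner_le_norm _ _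
      have h2 := norm_pos_iff.2 h
      nlinarith
  have hmem : (L : V →ₗ[ℝ] ℝ) ∘ₗ J ∈ LinearMap.range k.dualMap := by
    rw [LinearMap.range_dualMap_eq_dualAnnihilator_ker, Submodule.mem_dualAnnihilator]
    intro m hm
    have h1 := hJk m
    rw [LinearMap.mem_ker.1 hm, norm_zero] at h1
    have h2 : ‖J m‖ = 0 := le_antisymm (by nlinarith [norm_nonneg (J m)]) (norm_nonneg _)
    simp [norm_eq_zero.1 h2]
  obtain ⟨φ, hφ⟩ := hmem
  have hφ' : ∀ m, φ (k m) = L (J m) := fun m => LinearMap.congr_fun hφ m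
  let g₀ : LinearMap.range k →L[ℝ] ℝ :=
    (φ ∘ₗ (LinearMap.range k).subtype).mkContinuous (‖L‖ / c) (by
      rintro ⟨-, m, rfl⟩
      simp only [LinearMap.comp_apply, Submodule.subtype_apply, hφ', Submodule.coe_norm]
      calc ‖L (J m)‖ ≤ ‖L‖ * ‖J m‖ := L.le_opNorm _
        _ = ‖L‖ / c * (c * ‖J m‖) := by field_simp
        _ ≤ _ := by gcongr; exact hJk m)
  obtain ⟨g, hg, -⟩ := exists_extension_norm_eq _ g₀
  refine ⟨(InnerProductSpace.toDual ℝ V).symm g, fun m => ?_⟩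
  rw [← hk, real_inner_comm, InnerProductSpace.toDual_symm_apply]
  exact (hg ⟨k m, m, rfl⟩).trans (hφ' m)

/-- `exists_forall_eq_of_coercive` with the solution in a given closed subspace. -/
lemma exists_mem_forall_eq_of_coercive [CompleteSpace V] {M : Type*} [AddCommGroup M] [Module ℝ M]
    (S : Submodule ℝ V) (hS : IsClosed (S : Set V)) (J : M →ₗ[ℝ] V) (hJ : ∀ m, J m ∈ S)
    (K : M →ₗ[ℝ] V →L[ℝ] ℝ) {c : ℝ} (hc : 0 < c)
    (hK : ∀ m, c * ‖J m‖ ^ 2 ≤ K m (J m)) (L : V →L[ℝ] ℝ) : ∃ x ∈ S, ∀ m, K m x = L (J m) := by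
  have : CompleteSpace S := hS.completeSpace_coe
  obtain ⟨x, hx⟩ := exists_forall_eq_of_coercive (J.codRestrict S hJ)
    { toFun := fun m => (K m).comp S.subtypeL
      map_add' := fun a b => by ext; simp
      map_smul' := fun a b => by ext; simp } hc hK (L.comp S.subtypeL)
  exact ⟨x, x.2, hx⟩

end HilbertSpace

section Multiplication

variable {A : Type*} [MeasurableSpace A] {m : Measure A}

/-- Multiplication by a bounded function on `L²`. -/
noncomputable def mulL {b : A → ℝ} (hb : MemLp b ⊤ m) : Lp ℝ 2 m →L[ℝ] Lp ℝ 2 m :=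
  (ContinuousLinearMap.mul ℝ ℝ).holderL m ⊤ 2 2 hb.toLp

lemma coeFn_mulL {b : A → ℝ} (hb : MemLp b ⊤ m) (w : Lp ℝ 2 m) :
    mulL hb w =ᵐ[m] fun p => b p * w p := by
  have h := (ContinuousLinearMap.mul ℝ ℝ).coeFn_holder (r := 2) hb.toLp w
  filter_upwards [h, hb.coeFn_toLp] with p h1 h2
  simp only [mulL]
  rw [ContinuousLinearMap.holderL_apply_apply] at *
  rw [h1, ContinuousLinearMap.mul_apply', h2]

lemma integrable_mul_L2 (w z : Lp ℝ 2 m) : Integrable (fun p => w p * z p) m :=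
  (Lp.memLp w).integrable_mul (Lp.memLp z)

lemma inner_L2_eq (w z : Lp ℝ 2 m) : inner ℝ w z = ∫ p, w p * z p ∂m := by
  rw [L2.inner_def]
  simp [mul_comm]

lemma inner_mulL {b : A → ℝ} (hb : MemLp b ⊤ m) (w z : Lp ℝ 2 m) :
    inner ℝ (mulL hb w) z = ∫ p, b p * w p * z p ∂m := by
  rw [inner_L2_eq]
  refine integral_congr_ae ?_
  filter_upwards [coeFn_mulL hb w] with p hp
  rw [hp]

lemma integrable_mulL_mul {b : A → ℝ} (hb : MemLp b ⊤ m) (w z : Lp ℝ 2 m) :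
    Integrable (fun p => b p * w p * z p) m := by
  refine (integrable_mul_L2 (mulL hb w) z).congr ?_
  filter_upwards [coeFn_mulL hb w] with p hp
  rw [hp]

end Multiplication

namespace Problem

variable {n : ℕ} (P : Problem n)

/-- Lebesgue measure on `Ω`. -/
noncomputable def measΩ : Measure (EuclideanSpace ℝ (Fin n) × ℝ) :=
  volume.restrict (P.ω ×ˢ Ioo (-P.ℓ) P.ℓ)

instance : SFinite P.measΩ := by unfold measΩ; infer_instance

lemma measQ_eq : P.measQ = P.measΩ.prod (volume.restrict (Ioo 0 P.T)) := by
  rw [measQ, measΩ, Measure.prod_restrict]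
  rfl

instance : IsFiniteMeasureOnCompacts P.measQ := by unfold measQ; infer_instance

instance : IsFiniteMeasureOnCompacts P.measS := by unfold measS; infer_instance

/-- The test functions. -/
def testSpace : Submodule ℝ (SpaceTime n → ℝ) where
  carrier := {Φ | P.IsTest Φ}
  add_mem' := fun {f g} hf hg =>
    { smooth := hf.smooth.add hg.smooth
      compact := hf.compact.add hg.compact
      lateral := fun p hp => (tsupport_add f g hp).elim (hf.lateral p) (hg.lateral p) }
  zero_mem' :=
    { smooth := contDiff_const
      compact := HasCompactSupport.zero
      lateral := fun p hp => by simp [tsupport] at hp }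
  smul_mem' := fun c f hf =>
    { smooth := hf.smooth.const_smul c
      compact := HasCompactSupport.smul_left (f := fun _ => c) hf.compact
      lateral := fun p hp => hf.lateral p (tsupport_smul_subset_right (fun _ => c) f hp) }

variable {P}

lemma continuous_test (Φ : P.testSpace) : Continuous (Φ : SpaceTime n → ℝ) :=
  Φ.2.smooth.continuous

lemma differentiable_test (Φ : P.testSpace) : Differentiable ℝ (Φ : SpaceTime n → ℝ) :=
  Φ.2.smooth.differentiable (by simp)

lemma memLp_test (Φ : P.testSpace) : MemLp (Φ : SpaceTime n → ℝ) 2 P.measQ :=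
  (continuous_test Φ).memLp_of_hasCompactSupport Φ.2.compact

lemma hasCompactSupport_top (Φ : P.testSpace) :
    HasCompactSupport fun y : Lateral n => (Φ : SpaceTime n → ℝ) ((y.1, P.ℓ), y.2) := by
  refine HasCompactSupport.intro 
    (K := (fun p : SpaceTime n => (p.1.1, p.2)) '' tsupport (Φ : SpaceTime n → ℝ))
    (Φ.2.compact.isCompact.image (by fun_prop)) fun y hy => ?_
  by_contra hne
  exact hy ⟨((y.1, P.ℓ), y.2), subset_tsupport _ hne, rfl⟩

lemma memLp_top (Φ : P.testSpace) :
    MemLp (fun y : Lateral n => (Φ : SpaceTime n → ℝ) ((y.1, P.ℓ), y.2)) 2 P.measS :=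
  ((continuous_test Φ).comp (by fun_prop)).memLp_of_hasCompactSupport (hasCompactSupport_top Φ)

/-- The class of a test function in `L²(Q)`. -/
noncomputable def val : P.testSpace →ₗ[ℝ] P.L2Q where
  toFun Φ := (memLp_test Φ).toLp
  map_add' Φ Ψ := MemLp.toLp_add (memLp_test Φ) (memLp_test Ψ)
  map_smul' c Φ := MemLp.toLp_const_smul c (memLp_test Φ)

lemma coeFn_val (Φ : P.testSpace) : val Φ =ᵐ[P.measQ] (Φ : SpaceTime n → ℝ) :=
  (memLp_test Φ).coeFn_toLp

/-- The trace of a test function at `x_d = ℓ`. -/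
noncomputable def trace : P.testSpace →ₗ[ℝ] P.L2S where
  toFun Φ := (memLp_top Φ).toLp
  map_add' Φ Ψ := MemLp.toLp_add (memLp_top Φ) (memLp_top Ψ)
  map_smul' c Φ := MemLp.toLp_const_smul c (memLp_top Φ)

lemma coeFn_trace (Φ : P.testSpace) :
    trace Φ =ᵐ[P.measS] fun y => (Φ : SpaceTime n → ℝ) ((y.1, P.ℓ), y.2) :=
  (memLp_top Φ).coeFn_toLp

/-- The derivative of test functions in the direction `v`. -/
noncomputable def dirDeriv (v : SpaceTime n) : P.testSpace →ₗ[ℝ] P.testSpace where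
  toFun Φ := ⟨fun p => fderiv ℝ (Φ : SpaceTime n → ℝ) p v,
    { smooth := (Φ.2.smooth.fderiv_right (by simp)).clm_apply contDiff_const
      compact := Φ.2.compact.fderiv_apply ℝ v
      lateral := fun p hp => Φ.2.lateral p (tsupport_fderiv_apply_subset ℝ v hp) }⟩
  map_add' Φ Ψ := by
    ext p
    simp [fderiv_add (differentiable_test Φ p) (differentiable_test Ψ p)]
  map_smul' c Φ := by
    ext p
    simp [fderiv_const_smul (differentiable_test Φ p) c]

lemma dirDeriv_apply (v : SpaceTime n) (Φ : P.testSpace) (p : SpaceTime n) :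
    (dirDeriv v Φ : SpaceTime n → ℝ) p = fderiv ℝ (Φ : SpaceTime n → ℝ) p v := rfl

/-- The spatial partial derivatives of test functions. -/
noncomputable abbrev dxL (i : Fin (n + 1)) : P.testSpace →ₗ[ℝ] P.testSpace :=
  dirDeriv (dir n i, 0)

/-- The time derivative of test functions. -/
noncomputable abbrev dtL : P.testSpace →ₗ[ℝ] P.testSpace := dirDeriv (0, 1)

/-- Translation in time. -/
def transL (s : ℝ) : P.testSpace →ₗ[ℝ] P.testSpace where
  toFun Φ := ⟨fun p => (Φ : SpaceTime n → ℝ) (p + (0, s)),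
    { smooth := Φ.2.smooth.comp (contDiff_id.add contDiff_const)
      compact := Φ.2.compact.comp_homeomorph (Homeomorph.addRight ((0, s) : SpaceTime n))
      lateral := fun p hp => by
        have := Φ.2.lateral _ (tsupport_comp_subset_preimage (Φ : SpaceTime n → ℝ)
          (f := fun p : SpaceTime n => p + (0, s)) (by fun_prop) hp)
        simpa using this }⟩
  map_add' Φ Ψ := rfl
  map_smul' c Φ := rfl

lemma transL_apply (s : ℝ) (Φ : P.testSpace) (p : SpaceTime n) :
    (transL s Φ : SpaceTime n → ℝ) p = (Φ : SpaceTime n → ℝ) (p.1, p.2 + s) := by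
  have e : p + (0, s) = (p.1, p.2 + s) := by ext1 <;> simp
  rw [← e]
  rfl

lemma transL_zero (Φ : P.testSpace) : transL 0 Φ = Φ := by
  ext p
  rw [transL_apply, add_zero]

lemma tsupport_transL (s : ℝ) (Φ : P.testSpace) {p : SpaceTime n}
    (hp : p ∈ tsupport (transL s Φ : SpaceTime n → ℝ)) :
    (p.1, p.2 + s) ∈ tsupport (Φ : SpaceTime n → ℝ) := by
  have := tsupport_comp_subset_preimage (Φ : SpaceTime n → ℝ)
    (f := fun p : SpaceTime n => p + (0, s)) (by fun_prop) hp
  have e : p + (0, s) = (p.1, p.2 + s) := by ext1 <;> simp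
  rwa [mem_preimage, e] at this

lemma dirDeriv_transL (v : SpaceTime n) (s : ℝ) (Φ : P.testSpace) :
    dirDeriv v (transL s Φ) = transL s (dirDeriv v Φ) := by
  ext p
  exact congrArg (fun L : SpaceTime n →L[ℝ] ℝ => L v)
    (fderiv_comp_add_right (f := (Φ : SpaceTime n → ℝ)) (x := p) (0, s))

/-- Multiplication of test functions by a smooth function of time. -/
def mulTime {θ : ℝ → ℝ} (hθ : ContDiff ℝ ((⊤ : ℕ∞) : WithTop ℕ∞) θ) (Φ : P.testSpace) :
    P.testSpace :=
  ⟨fun p => θ p.2 * (Φ : SpaceTime n → ℝ) p,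
    { smooth := (hθ.comp contDiff_snd).mul Φ.2.smooth
      compact := Φ.2.compact.mul_left (f := fun p : SpaceTime n => θ p.2)
      lateral := fun p hp => Φ.2.lateral p
        (tsupport_mul_subset_right (f := fun p : SpaceTime n => θ p.2) hp) }⟩

lemma dxL_mulTime {θ : ℝ → ℝ} (hθ : ContDiff ℝ ((⊤ : ℕ∞) : WithTop ℕ∞) θ) (Φ : P.testSpace)
    (i : Fin (n + 1)) : dxL i (mulTime hθ Φ) = mulTime hθ (dxL i Φ) := by
  ext p
  have h1 : HasFDerivAt (fun p : SpaceTime n => θ p.2)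
      ((fderiv ℝ θ p.2).comp (ContinuousLinearMap.snd ℝ _ _)) p :=
    ((hθ.differentiable (by simp)) p.2).hasFDerivAt.comp p hasFDerivAt_snd
  have h2 := (h1.mul (differentiable_test Φ p).hasFDerivAt).fderiv
  have e : (dxL i (mulTime hθ Φ) : SpaceTime n → ℝ) p
      = fderiv ℝ ((fun p : SpaceTime n => θ p.2) * (Φ : SpaceTime n → ℝ)) p (dir n i, 0) := rfl
  rw [e, h2]
  simp [mulTime, dirDeriv_apply]

variable (P) in
/-- The Hilbert space of the triples of a function, its spatial gradient and its trace. -/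
abbrev Triple : Type := WithLp 2 (P.L2Q × WithLp 2 (PiLp 2 (fun _ : Fin (n + 1) => P.L2Q) × P.L2S))

/-- The function in a triple. -/
noncomputable def fnL : P.Triple →L[ℝ] P.L2Q := WithLp.fstL 2 ℝ _ _

/-- The gradient in a triple. -/
noncomputable def gradL (i : Fin (n + 1)) : P.Triple →L[ℝ] P.L2Q :=
  (PiLp.proj 2 (fun _ : Fin (n + 1) => P.L2Q) i).comp
    ((WithLp.fstL 2 ℝ _ _).comp (WithLp.sndL 2 ℝ _ _))

/-- The trace in a triple. -/
noncomputable def traceL : P.Triple →L[ℝ] P.L2S :=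
  (WithLp.sndL 2 ℝ _ _).comp (WithLp.sndL 2 ℝ _ _)

/-- The triple with given components. -/
noncomputable def mkTriple (u : P.L2Q) (G : Fin (n + 1) → P.L2Q) (τ : P.L2S) : P.Triple :=
  WithLp.toLp 2 (u, WithLp.toLp 2 (WithLp.toLp 2 G, τ))

lemma mkTriple_components (x : P.Triple) :
    mkTriple (fnL x) (fun i => gradL i x) (traceL x) = x := rfl

lemma norm_triple_sq (x : P.Triple) :
    ‖x‖ ^ 2 = ‖fnL x‖ ^ 2 + ((∑ i, ‖gradL i x‖ ^ 2) + ‖traceL x‖ ^ 2) := by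
  rw [WithLp.prod_norm_sq_eq_of_L2, WithLp.prod_norm_sq_eq_of_L2, PiLp.norm_sq_eq_of_L2]
  rfl

/-- The triple of a test function. -/
noncomputable def testTriple : P.testSpace →ₗ[ℝ] P.Triple where
  toFun Φ := mkTriple (val Φ) (fun i => val (dxL i Φ)) (trace Φ)
  map_add' Φ Ψ := by simp only [map_add]; rfl
  map_smul' c Φ := by simp only [map_smul]; rfl

@[simp] lemma fnL_testTriple (Φ : P.testSpace) : fnL (testTriple Φ) = val Φ := rfl

@[simp] lemma gradL_testTriple (Φ : P.testSpace) (i : Fin (n + 1)) :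
    gradL i (testTriple Φ) = val (dxL i Φ) := rfl

@[simp] lemma traceL_testTriple (Φ : P.testSpace) : traceL (testTriple Φ) = trace Φ := rfl

variable (P) in
/-- The space `L²(0,T; V)`, as a space of triples. -/
noncomputable def energySpace : Submodule ℝ P.Triple :=
  (LinearMap.range (testTriple (P := P))).topologicalClosure

lemma isClosed_energySpace : IsClosed (P.energySpace : Set P.Triple) :=
  Submodule.isClosed_topologicalClosure _

lemma testTriple_mem (Φ : P.testSpace) : testTriple Φ ∈ P.energySpace :=
  Submodule.le_topologicalClosure _ ⟨Φ, rfl⟩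

lemma exists_seq_of_mem_energySpace {x : P.Triple} (hx : x ∈ P.energySpace) :
    ∃ Φ : ℕ → P.testSpace, Tendsto (fun k => testTriple (Φ k)) atTop (𝓝 x) := by
  have hx' : x ∈ closure (range (testTriple (P := P))) := by
    rw [energySpace, ← SetLike.mem_coe, Submodule.topologicalClosure_coe] at hx
    exact hx
  obtain ⟨y, hy, hlim⟩ := mem_closure_iff_seq_limit.1 hx'
  choose Φ hΦ using hy
  exact ⟨Φ, by simpa [hΦ] using hlim⟩

lemma enorm_sub_eq {A : Type*} [MeasurableSpace A] {m : Measure A} {w : A → ℝ} {z u : Lp ℝ 2 m}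
    (h : z =ᵐ[m] w) : eLpNorm (fun p => w p - u p) 2 m = ENNReal.ofReal ‖z - u‖ := by
  rw [ofReal_norm, Lp.enorm_def]
  refine eLpNorm_congr_ae ?_
  filter_upwards [h, Lp.coeFn_sub z u] with p h1 h2
  rw [h2, Pi.sub_apply, h1]

lemma tendsto_eLpNorm_sub_iff {A : Type*} [MeasurableSpace A] {m : Measure A} {w : ℕ → A → ℝ}
    {z : ℕ → Lp ℝ 2 m} {u : Lp ℝ 2 m} (h : ∀ k, z k =ᵐ[m] w k) :
    Tendsto (fun k => eLpNorm (fun p => w k p - u p) 2 m) atTop (𝓝 0) ↔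
      Tendsto z atTop (𝓝 u) := by
  simp only [fun k => enorm_sub_eq (u := u) (h k)]
  rw [tendsto_iff_norm_sub_tendsto_zero]
  constructor
  · intro h
    simpa [Function.comp_def] using (ENNReal.tendsto_toReal ENNReal.zero_ne_top).comp h
  · intro h
    simpa using ENNReal.tendsto_ofReal h

lemma tendsto_triple_iff {x : ℕ → P.Triple} {y : P.Triple} :
    Tendsto x atTop (𝓝 y) ↔ Tendsto (fun k => fnL (x k)) atTop (𝓝 (fnL y)) ∧
      (∀ i, Tendsto (fun k => gradL i (x k)) atTop (𝓝 (gradL i y))) ∧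
      Tendsto (fun k => traceL (x k)) atTop (𝓝 (traceL y)) := by
  constructor
  · intro h
    exact ⟨(fnL.continuous.tendsto y).comp h, fun i => ((gradL i).continuous.tendsto y).comp h,
      (traceL.continuous.tendsto y).comp h⟩
  · rintro ⟨h1, h2, h3⟩
    rw [tendsto_iff_norm_sub_tendsto_zero] at h1 h3 ⊢
    have h2' := fun i => tendsto_iff_norm_sub_tendsto_zero.1 (h2 i)
    have h4 : Tendsto (fun k => ‖x k - y‖ ^ 2) atTop (𝓝 0) := by
      simp only [norm_triple_sq, map_sub]
      have := (h1.pow 2).add ((tendsto_finsetSum Finset.univ fun i _ => (h2' i).pow 2).add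
        (h3.pow 2))
      simpa using this
    have := h4.sqrt
    simpa using this

lemma isEnergy_iff (u : P.L2Q) (G : Fin (n + 1) → P.L2Q) (τ : P.L2S) :
    P.IsEnergy u G τ ↔ mkTriple u G τ ∈ P.energySpace := by
  have key : ∀ Φ : ℕ → P.testSpace,
      (Tendsto (fun k => eLpNorm (fun p => (Φ k : SpaceTime n → ℝ) p - u p) 2 P.measQ) atTop (𝓝 0) ∧
      (∀ i, Tendsto (fun k => eLpNorm (fun p => dx i (Φ k : SpaceTime n → ℝ) p - G i p) 2 P.measQ)
        atTop (𝓝 0)) ∧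
      Tendsto (fun k => eLpNorm (fun y : Lateral n =>
        (Φ k : SpaceTime n → ℝ) ((y.1, P.ℓ), y.2) - τ y) 2 P.measS) atTop (𝓝 0)) ↔
      Tendsto (fun k => testTriple (Φ k)) atTop (𝓝 (mkTriple u G τ)) := by
    intro Φ
    rw [tendsto_triple_iff, tendsto_eLpNorm_sub_iff fun k => coeFn_val (Φ k),
      tendsto_eLpNorm_sub_iff fun k => coeFn_trace (Φ k)]
    refine and_congr Iff.rfl (and_congr (forall_congr' fun i => ?_) Iff.rfl)
    exact tendsto_eLpNorm_sub_iff fun k => coeFn_val (dxL i (Φ k))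
  constructor
  · rintro ⟨Φ, hΦ, h⟩
    have := (key fun k => ⟨Φ k, hΦ k⟩).1 h
    exact isClosed_energySpace.mem_of_tendsto this (Eventually.of_forall fun k => testTriple_mem _)
  · intro h
    obtain ⟨Φ, hΦ⟩ := exists_seq_of_mem_energySpace h
    exact ⟨fun k => Φ k, fun k => (Φ k).2, (key Φ).2 hΦ⟩

end Problem
lemma abs_integral_mul_mul_le {A : Type*} [MeasurableSpace A] {m : Measure A} {c : A → ℝ} {C : ℝ}
    (hc : ∀ᵐ p ∂m, |c p| ≤ C) (w z : Lp ℝ 2 m) :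
    |∫ p, c p * w p * z p ∂m| ≤ C * (‖w‖ * ‖z‖) := by
  rcases eq_or_ne m 0 with rfl | hm
  · have h0 : ∀ u : Lp ℝ 2 (0 : Measure A), ‖u‖ = 0 := fun u => by simp [Lp.norm_def]
    simp [h0]
  have : (ae m).NeBot := ae_neBot.2 hm
  have hC : 0 ≤ C := by
    obtain ⟨p, hp⟩ := hc.exists
    exact (abs_nonneg _).trans hp
  have h1 : ∀ᵐ p ∂m, ‖c p * w p * z p‖ ≤ C * ((|w| : Lp ℝ 2 m) p * (|z| : Lp ℝ 2 m) p) := by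
    filter_upwards [hc, Lp.coeFn_abs w, Lp.coeFn_abs z] with p h1 h2 h3
    rw [h2, h3, mul_assoc, Real.norm_eq_abs, abs_mul, abs_mul]
    gcongr
  have h2 := norm_integral_le_of_norm_le ((integrable_mul_L2 |w| |z|).const_mul C) h1
  rw [integral_const_mul, ← inner_L2_eq] at h2
  refine h2.trans (mul_le_mul_of_nonneg_left ?_ hC)
  simpa only [norm_abs_eq_norm] using real_inner_le_norm |w| |z|

namespace Problem

variable {n : ℕ} {P : Problem n}

/-- Lebesgue measure on `ω`. -/
noncomputable def measω (P : Problem n) : Measure (EuclideanSpace ℝ (Fin n)) :=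
  volume.restrict P.ω

instance : SFinite P.measω := by unfold measω; infer_instance

instance : SFinite P.measS := by unfold measS; infer_instance

lemma measQ_eq_prod : P.measQ = (P.measω.prod (volume.restrict (Ioo (-P.ℓ) P.ℓ))).prod
    (volume.restrict (Ioo 0 P.T)) := by
  rw [measQ, measω, Measure.prod_restrict, Measure.prod_restrict]
  rfl

lemma measS_eq_prod : P.measS = P.measω.prod (volume.restrict (Ioo 0 P.T)) := by
  rw [measS, measω, Measure.prod_restrict, Measure.volume_eq_prod]

/-- `Q` as the product of `ω × (0,T)` and `(-ℓ, ℓ)`. -/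
lemma measurePreserving_swapRight_measQ :
    MeasurePreserving swapRight P.measQ (P.measS.prod (volume.restrict (Ioo (-P.ℓ) P.ℓ))) := by
  rw [measQ_eq_prod, measS_eq_prod]
  exact measurePreserving_swapRight _ _

lemma integrable_swapRight {F : SpaceTime n → ℝ} (hF : Integrable F P.measQ) :
    Integrable (fun q : Lateral n × ℝ => F ((q.1.1, q.2), q.1.2))
      (P.measS.prod (volume.restrict (Ioo (-P.ℓ) P.ℓ))) := by
  rw [measQ_eq_prod] at hF
  rw [measS_eq_prod]
  exact (measurePreserving_swapRight _ _).integrable_comp_of_integrable hF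

lemma integral_measQ_eq {F : SpaceTime n → ℝ} (hF : Integrable F P.measQ) :
    ∫ p, F p ∂P.measQ = ∫ y, (∫ s in Ioo (-P.ℓ) P.ℓ, F ((y.1, s), y.2)) ∂P.measS := by
  have hI := integrable_swapRight hF
  have hmp := measurePreserving_swapRight_measQ (P := P)
  rw [← integral_prod _ hI, ← hmp.map_eq, integral_map hmp.measurable.aemeasurable
    (by rw [hmp.map_eq]; exact hI.aestronglyMeasurable)]
  rfl

lemma integral_measQ_eq_zero {F : SpaceTime n → ℝ} (hF : Integrable F P.measQ)
    (h : ∀ s t, ∫ y in P.ω, F ((y, s), t) = 0) : ∫ p, F p ∂P.measQ = 0 := by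
  rw [measQ_eq_prod] at hF ⊢
  have hmp := (measurePreserving_prodAssoc P.measω (volume.restrict (Ioo (-P.ℓ) P.ℓ))
    (volume.restrict (Ioo 0 P.T))).symm
  have hI := hmp.integrable_comp_of_integrable hF
  rw [← hmp.map_eq, integral_map hmp.measurable.aemeasurable
    (by rw [hmp.map_eq]; exact hF.aestronglyMeasurable)]
  refine (integral_prod_symm _ hI).trans ?_
  refine (integral_congr_ae (Eventually.of_forall fun z => ?_)).trans (integral_zero _ _)
  exact h z.1 z.2

lemma integrable_of_continuous_mul_test {F : SpaceTime n → ℝ} (hF : Continuous F)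
    (Φ : P.testSpace) : Integrable (fun p => F p * (Φ : SpaceTime n → ℝ) p) P.measQ :=
  (hF.mul (continuous_test Φ)).integrable_of_hasCompactSupport Φ.2.compact.mul_left

lemma norm_val_sq (Φ : P.testSpace) :
    ‖val Φ‖ ^ 2 = ∫ p, (Φ : SpaceTime n → ℝ) p ^ 2 ∂P.measQ := by
  rw [← integral_sq_eq_norm_sq]
  refine integral_congr_ae ?_
  filter_upwards [coeFn_val Φ] with p hp
  rw [hp]

lemma norm_trace_sq (Φ : P.testSpace) :
    ‖trace Φ‖ ^ 2 = ∫ y, (Φ : SpaceTime n → ℝ) ((y.1, P.ℓ), y.2) ^ 2 ∂P.measS := by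
  rw [← integral_sq_eq_norm_sq]
  refine integral_congr_ae ?_
  filter_upwards [coeFn_trace Φ] with p hp
  rw [hp]

lemma abs_integral_test_le {c : SpaceTime n → ℝ} {C : ℝ} (hc : ∀ᵐ p ∂P.measQ, |c p| ≤ C)
    (Φ Ψ : P.testSpace) :
    |∫ p, c p * (Φ : SpaceTime n → ℝ) p * (Ψ : SpaceTime n → ℝ) p ∂P.measQ|
      ≤ C * (‖val Φ‖ * ‖val Ψ‖) := by
  refine le_trans (le_of_eq ?_) (abs_integral_mul_mul_le hc (val Φ) (val Ψ))
  congr 1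
  refine integral_congr_ae ?_
  filter_upwards [coeFn_val Φ, coeFn_val Ψ] with p h1 h2
  rw [h1, h2]

lemma dir_castSucc (i : Fin n) : dir n i.castSucc = (EuclideanSpace.single i 1, 0) := by
  simp [dir]

lemma dir_last : dir n (Fin.last n) = (0, 1) := by
  simp [dir]

lemma ae_mem_measQ (hP : P.Admissible) :
    ∀ᵐ p ∂P.measQ, p ∈ (P.ω ×ˢ Ioo (-P.ℓ) P.ℓ) ×ˢ Ioo 0 P.T :=
  ae_restrict_mem ((hP.isOpen_ω.measurableSet.prod measurableSet_Ioo).prod measurableSet_Ioo)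

/-- Poincaré's inequality. -/
lemma poincare (hP : P.Admissible) {M : ℝ} (hM : ∀ y ∈ P.ω, ‖y‖ ≤ M) (i : Fin n)
    (Φ : P.testSpace) : ‖val Φ‖ ≤ 2 * M * ‖val (dxL i.castSucc Φ)‖ := by
  set φ : SpaceTime n → ℝ := Φ.1
  set φi : SpaceTime n → ℝ := (dxL i.castSucc Φ).1
  have hφc : Continuous φ := continuous_test Φ
  have hφic : Continuous φi := continuous_test (dxL i.castSucc Φ)
  have hI1 : Integrable (fun p => φ p ^ 2) P.measQ := (memLp_test Φ).integrable_sq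
  have hI2 : Integrable (fun p : SpaceTime n => 2 * p.1.1 i * φ p * φi p) P.measQ :=
    integrable_of_continuous_mul_test (F := fun p : SpaceTime n => 2 * p.1.1 i * φ p)
      (by fun_prop) (dxL i.castSucc Φ)
  have key : ∫ p, (φ p ^ 2 + 2 * p.1.1 i * φ p * φi p) ∂P.measQ = 0 := by
    refine integral_measQ_eq_zero (hI1.add hI2) fun s t => ?_
    set g : EuclideanSpace ℝ (Fin n) → ℝ := fun y => y i * φ ((y, s), t) ^ 2
    set g' : EuclideanSpace ℝ (Fin n) → ℝ := fun y =>
      φ ((y, s), t) ^ 2 + 2 * y i * φ ((y, s), t) * φi ((y, s), t)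
    have hd : ∀ y, HasLineDerivAt ℝ g (g' y) y (EuclideanSpace.single i 1) := by
      intro y
      have h0 : HasDerivAt (fun r : ℝ => φ ((y + r • EuclideanSpace.single i 1, s), t))
          (φi ((y, s), t)) 0 := by
        have h1 : HasDerivAt (fun r : ℝ => (((y + r • EuclideanSpace.single i (1 : ℝ), s), t) :
            SpaceTime n)) (dir n i.castSucc, 0) 0 := by
          rw [dir_castSucc]
          refine HasDerivAt.prodMk (HasDerivAt.prodMk ?_ (hasDerivAt_const _ _))
            (hasDerivAt_const _ _)
          simpa using ((hasDerivAt_id (0 : ℝ)).smul_const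
            (EuclideanSpace.single i (1 : ℝ))).const_add y
        have h2 : HasFDerivAt φ (fderiv ℝ φ ((y, s), t))
            ((y + (0 : ℝ) • EuclideanSpace.single i (1 : ℝ), s), t) := by
          simpa using (differentiable_test Φ ((y, s), t)).hasFDerivAt
        exact h2.comp_hasDerivAt (0 : ℝ) h1
      have h3 : HasDerivAt (fun r : ℝ => (y + r • EuclideanSpace.single i (1 : ℝ)) i) 1 0 := by
        simpa using (hasDerivAt_id (0 : ℝ)).const_add (y i)
      have h4 := h3.mul (h0.pow 2)
      refine h4.congr_deriv ?_
      simp [g']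
      ring
    have hcs : ∀ f : EuclideanSpace ℝ (Fin n) → ℝ, Continuous f →
        (∀ y, φ ((y, s), t) = 0 → f y = 0) → Integrable f := by
      intro f hf h
      refine hf.integrable_of_hasCompactSupport (HasCompactSupport.intro
        (K := (fun p : SpaceTime n => p.1.1) '' tsupport φ)
        (Φ.2.compact.isCompact.image (by fun_prop)) fun y hy => h y ?_)
      by_contra hne
      exact hy ⟨((y, s), t), subset_tsupport _ hne, rfl⟩
    have hz : ∫ y, g' y = 0 := by
      have := integral_bilinear_hasLineDerivAt_right_eq_neg_left_of_integrable
        (μ := (volume : Measure (EuclideanSpace ℝ (Fin n))))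
        (f := fun _ => (1 : ℝ)) (f' := fun _ => 0) (g := g) (g' := g')
        (v := EuclideanSpace.single i 1) (B := ContinuousLinearMap.mul ℝ ℝ)
        (by simp) (by
          simp only [ContinuousLinearMap.mul_apply', one_mul]
          exact hcs g' (by fun_prop) (fun y h => by simp [g', h])) (by
          simp only [ContinuousLinearMap.mul_apply', one_mul]
          exact hcs g (by fun_prop) (fun y h => by simp [g, h]))
        (fun y _ => by simpa [HasLineDerivAt] using hasDerivAt_const (0 : ℝ) (1 : ℝ))
        (fun y _ => hd y)
      simpa using this
    refine (setIntegral_eq_integral_of_forall_compl_eq_zero fun y hy => ?_).trans hz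
    have : φ ((y, s), t) = 0 := image_eq_zero_of_notMem_tsupport fun h => hy (Φ.2.lateral _ h)
    simp [this]
  rw [integral_add hI1 hI2, ← norm_val_sq] at key
  have hb := abs_integral_test_le (P := P) (c := fun p => 2 * p.1.1 i) (C := 2 * M) (by
    filter_upwards [ae_mem_measQ hP] with p hp
    rw [abs_mul, abs_two]
    have h1 : |p.1.1 i| ≤ ‖p.1.1‖ := PiLp.norm_apply_le p.1.1 i
    have h2 := hM _ hp.1.1
    linarith) Φ (dxL i.castSucc Φ)
  have h5 := (neg_le_abs _).trans hb
  rcases eq_or_lt_of_le (norm_nonneg (val Φ)) with h0 | h0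
  · rw [← h0] at key hb ⊢
    rcases P.ω.eq_empty_or_nonempty with he | ⟨y, hy⟩
    · have hm : P.measQ = 0 := by simp [measQ, he]
      have : ‖val (dxL i.castSucc Φ)‖ = 0 := by simp [Lp.norm_def, hm]
      simp [this]
    · have := (norm_nonneg y).trans (hM y hy)
      positivity
  · nlinarith

/-- The trace inequality. -/
lemma trace_inequality (hP : P.Admissible) (Φ : P.testSpace) :
    2 * P.ℓ * ‖trace Φ‖ ^ 2 ≤
      ‖val Φ‖ ^ 2 + 4 * P.ℓ * (‖val Φ‖ * ‖val (dxL (Fin.last n) Φ)‖) := by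
  have hℓ := hP.ℓ_pos
  set φ : SpaceTime n → ℝ := Φ.1
  set φd : SpaceTime n → ℝ := (dxL (Fin.last n) Φ).1
  have hφc : Continuous φ := continuous_test Φ
  have hφdc : Continuous φd := continuous_test (dxL (Fin.last n) Φ)
  have hI1 : Integrable (fun p => φ p ^ 2) P.measQ := (memLp_test Φ).integrable_sq
  have hI2 : Integrable (fun p : SpaceTime n => 2 * (p.1.2 + P.ℓ) * φ p * φd p) P.measQ :=
    integrable_of_continuous_mul_test (F := fun p : SpaceTime n => 2 * (p.1.2 + P.ℓ) * φ p)
      (by fun_prop) (dxL (Fin.last n) Φ)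
  have key : ∫ p, (φ p ^ 2 + 2 * (p.1.2 + P.ℓ) * φ p * φd p) ∂P.measQ
      = 2 * P.ℓ * ‖trace Φ‖ ^ 2 := by
    rw [integral_measQ_eq (F := fun p => φ p ^ 2 + 2 * (p.1.2 + P.ℓ) * φ p * φd p)
      (hI1.add hI2), norm_trace_sq, ← integral_const_mul]
    congr 1; ext y
    rw [← integral_Ioc_eq_integral_Ioo, ← intervalIntegral.integral_of_le (by linarith)]
    rw [intervalIntegral.integral_eq_sub_of_hasDerivAt
      (f := fun s => (s + P.ℓ) * φ ((y.1, s), y.2) ^ 2)]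
    · simp only [φ]; ring
    · intro s _
      have h1 : HasDerivAt (fun s : ℝ => (((y.1, s), y.2) : SpaceTime n))
          (dir n (Fin.last n), 0) s := by
        rw [dir_last]
        exact ((hasDerivAt_const _ _).prodMk (hasDerivAt_id s)).prodMk (hasDerivAt_const _ _)
      have h2 : HasDerivAt (fun s : ℝ => φ ((y.1, s), y.2)) (φd ((y.1, s), y.2)) s :=
        (differentiable_test Φ ((y.1, s), y.2)).hasFDerivAt.comp_hasDerivAt s h1
      refine (((hasDerivAt_id s).add_const P.ℓ).mul (h2.pow 2)).congr_deriv ?_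
      simp
      ring
    · exact Continuous.intervalIntegrable (by fun_prop) _ _
  rw [integral_add hI1 hI2, ← norm_val_sq] at key
  have hb := abs_integral_test_le (P := P) (c := fun p => 2 * (p.1.2 + P.ℓ)) (C := 4 * P.ℓ) (by
    filter_upwards [ae_mem_measQ hP] with p hp
    obtain ⟨⟨-, h1, h2⟩, -⟩ := hp
    rw [abs_le]
    constructor <;> linarith) Φ (dxL (Fin.last n) Φ)
  have h5 := (le_abs_self _).trans hb
  linarith

lemma exists_norm_testTriple_le (hn : 1 ≤ n) (hP : P.Admissible) :
    ∃ C > 0, ∀ Φ : P.testSpace, ‖testTriple Φ‖ ^ 2 ≤ C * ∑ i, ‖val (dxL i Φ)‖ ^ 2 := by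
  obtain ⟨M, hM0, hM⟩ : ∃ M > 0, ∀ y ∈ P.ω, ‖y‖ ≤ M := hP.isBounded_ω.exists_pos_norm_le
  have hℓ := hP.ℓ_pos
  refine ⟨4 * M ^ 2 + (1 + (4 * M ^ 2 + 8 * P.ℓ * M) / (2 * P.ℓ)), by positivity, fun Φ => ?_⟩
  set S := ∑ i, ‖val (dxL i Φ)‖ ^ 2 with hS
  have hle : ∀ i, ‖val (dxL i Φ)‖ ^ 2 ≤ S := fun i =>
    Finset.single_le_sum (f := fun i => ‖val (dxL i Φ)‖ ^ 2) (fun _ _ => sq_nonneg _)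
      (Finset.mem_univ i)
  have h1 := poincare hP hM ⟨0, hn⟩ Φ
  have h2 := trace_inequality hP Φ
  set a := ‖val (dxL (Fin.castSucc ⟨0, hn⟩) Φ)‖
  set b := ‖val (dxL (Fin.last n) Φ)‖
  have ha : a ^ 2 ≤ S := hle _
  have hb : b ^ 2 ≤ S := hle _
  have ha0 : 0 ≤ a := norm_nonneg _
  have hb0 : 0 ≤ b := norm_nonneg _
  have hab : a * b ≤ S := by nlinarith [sq_nonneg (a - b)]
  have h3 : ‖val Φ‖ ^ 2 ≤ 4 * M ^ 2 * S := by
    calc ‖val Φ‖ ^ 2 ≤ (2 * M * a) ^ 2 := by gcongr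
      _ = 4 * M ^ 2 * a ^ 2 := by ring
      _ ≤ _ := by gcongr
  have h4 : ‖val Φ‖ * b ≤ 2 * M * S := by
    calc ‖val Φ‖ * b ≤ 2 * M * a * b := by gcongr
      _ = 2 * M * (a * b) := by ring
      _ ≤ _ := by gcongr
  have h5 : ‖trace Φ‖ ^ 2 ≤ (4 * M ^ 2 + 8 * P.ℓ * M) / (2 * P.ℓ) * S := by
    rw [div_mul_eq_mul_div, le_div_iff₀ (by positivity)]
    nlinarith [mul_le_mul_of_nonneg_left h4 hℓ.le]
  rw [norm_triple_sq]
  simp only [fnL_testTriple, gradL_testTriple, traceL_testTriple]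
  linarith

lemma norm_val_transL_le {s : ℝ} (Φ : P.testSpace)
    (hΦ : ∀ p, p.2 ∉ Ioo 0 P.T → (Φ : SpaceTime n → ℝ) p = 0) :
    ‖val (transL s Φ)‖ ≤ ‖val Φ‖ := by
  refine le_of_sq_le_sq ?_ (norm_nonneg _)
  have h1 : Integrable (fun p => (Φ : SpaceTime n → ℝ) p ^ 2) P.measQ :=
    (memLp_test Φ).integrable_sq
  have h2 : Integrable (fun p => (transL s Φ : SpaceTime n → ℝ) p ^ 2) P.measQ :=
    (memLp_test (transL s Φ)).integrable_sq
  rw [norm_val_sq, norm_val_sq]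
  rw [measQ_eq] at h1 h2 ⊢
  rw [integral_prod _ h1, integral_prod _ h2]
  refine integral_mono h2.integral_prod_left h1.integral_prod_left fun x => ?_
  simp only [transL_apply]
  have e : ∫ t in Ioo 0 P.T, (Φ : SpaceTime n → ℝ) (x, t) ^ 2
      = ∫ t, (Φ : SpaceTime n → ℝ) (x, t + s) ^ 2 := by
    rw [integral_add_right_eq_self (fun t => (Φ : SpaceTime n → ℝ) (x, t) ^ 2)]
    exact setIntegral_eq_integral_of_forall_compl_eq_zero fun t ht => by simp [hΦ (x, t) ht]
  rw [e]
  refine setIntegral_le_integral ?_ (Eventually.of_forall fun t => sq_nonneg _)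
  have hc : Continuous fun t => (Φ : SpaceTime n → ℝ) (x, t + s) ^ 2 :=
    ((continuous_test Φ).comp (by fun_prop)).pow 2
  refine hc.integrable_of_hasCompactSupport (HasCompactSupport.intro
    (K := (fun p : SpaceTime n => p.2 - s) '' tsupport (Φ : SpaceTime n → ℝ))
    (Φ.2.compact.isCompact.image (by fun_prop)) fun t ht => ?_)
  by_contra hne
  exact ht ⟨(x, t + s), subset_tsupport _ fun h => hne (by simp [h]), by simp⟩

lemma isFiniteMeasure_measQ (hP : P.Admissible) : IsFiniteMeasure P.measQ := by
  refine ⟨?_⟩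
  rw [measQ, Measure.restrict_apply_univ]
  exact ((hP.isBounded_ω.prod (Metric.isBounded_Ioo _ _)).prod
    (Metric.isBounded_Ioo _ _)).measure_lt_top

lemma exists_bound_test (Φ : P.testSpace) :
    ∃ C, ∀ p, ‖(Φ : SpaceTime n → ℝ) p‖ ≤ C :=
  (continuous_test Φ).bounded_above_of_compact_support Φ.2.compact

lemma hasDerivAt_time (Φ : P.testSpace) (x : EuclideanSpace ℝ (Fin n) × ℝ) (t : ℝ) :
    HasDerivAt (fun t => (Φ : SpaceTime n → ℝ) (x, t)) ((dtL Φ : SpaceTime n → ℝ) (x, t)) t := by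
  have h1 : HasDerivAt (fun t : ℝ => ((x, t) : SpaceTime n)) (0, 1) t :=
    (hasDerivAt_const _ _).prodMk (hasDerivAt_id t)
  exact (differentiable_test Φ (x, t)).hasFDerivAt.comp_hasDerivAt t h1

lemma hasDerivAt_val_transL (hP : P.Admissible) (Φ : P.testSpace) (s : ℝ) :
    HasDerivAt (fun s => val (transL s Φ)) (val (transL s (dtL Φ))) s := by
  have := isFiniteMeasure_measQ hP
  obtain ⟨C, hC⟩ := exists_bound_test (dtL (dtL Φ))
  have hC0 : 0 ≤ C := (norm_nonneg _).trans (hC 0)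
  have hdt : ∀ (Ψ : P.testSpace) (x : EuclideanSpace ℝ (Fin n) × ℝ) (t r : ℝ),
      HasDerivAt (fun r => (Ψ : SpaceTime n → ℝ) (x, t + r)) ((dtL Ψ : SpaceTime n → ℝ) (x, t + r))
        r := fun Ψ x t r => by
    simpa using (hasDerivAt_time Ψ x (t + r)).comp_const_add t r
  have hpt : ∀ (x : EuclideanSpace ℝ (Fin n) × ℝ) (t r : ℝ),
      ‖(Φ : SpaceTime n → ℝ) (x, t + r) - (Φ : SpaceTime n → ℝ) (x, t + s)
        - (r - s) * (dtL Φ : SpaceTime n → ℝ) (x, t + s)‖ ≤ C * ‖r - s‖ ^ 2 := by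
    intro x t r
    have hlip : ∀ r', ‖(dtL Φ : SpaceTime n → ℝ) (x, t + r')
        - (dtL Φ : SpaceTime n → ℝ) (x, t + s)‖ ≤ C * ‖r' - s‖ := fun r' =>
      convex_univ.norm_image_sub_le_of_norm_hasDerivWithin_le
        (fun r _ => (hdt (dtL Φ) x t r).hasDerivWithinAt) (fun r _ => hC _) (mem_univ _)
        (mem_univ _)
    have hd : ∀ r, HasDerivAt (fun r => (Φ : SpaceTime n → ℝ) (x, t + r)
        - r * (dtL Φ : SpaceTime n → ℝ) (x, t + s))
        ((dtL Φ : SpaceTime n → ℝ) (x, t + r) - (dtL Φ : SpaceTime n → ℝ) (x, t + s)) r :=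
      fun r => ((hdt Φ x t r).sub ((hasDerivAt_id r).mul_const
        ((dtL Φ : SpaceTime n → ℝ) (x, t + s)))).congr_deriv (by simp)
    have h2 := (convex_segment (𝕜 := ℝ) s r).norm_image_sub_le_of_norm_hasDerivWithin_le
      (f := fun r => (Φ : SpaceTime n → ℝ) (x, t + r)
        - r * (dtL Φ : SpaceTime n → ℝ) (x, t + s))
      (f' := fun r => (dtL Φ : SpaceTime n → ℝ) (x, t + r)
        - (dtL Φ : SpaceTime n → ℝ) (x, t + s))
      (C := C * ‖r - s‖)
      (fun r _ => (hd r).hasDerivWithinAt)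
      (fun r' hr' => (hlip r').trans (by
        gcongr
        rw [segment_eq_uIcc] at hr'
        exact abs_sub_left_of_mem_uIcc hr'))
      (left_mem_segment ℝ s r) (right_mem_segment ℝ s r)
    refine le_trans (le_of_eq ?_) (h2.trans (le_of_eq (by ring)))
    congr 1
    ring
  have hnorm : ∀ r, ‖val (transL r Φ) - val (transL s Φ) - (r - s) • val (transL s (dtL Φ))‖
      ≤ (C * (measureUnivNNReal P.measQ : ℝ) ^ ((2 : ENNReal).toReal)⁻¹) * ‖r - s‖ ^ 2 := by
    intro r
    have e : val (transL r Φ) - val (transL s Φ) - (r - s) • val (transL s (dtL Φ))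
        = val (transL r Φ - transL s Φ - (r - s) • transL s (dtL Φ)) := by
      simp only [map_sub, map_smul]
    rw [e]
    refine (Lp.norm_le_of_ae_bound (C := C * ‖r - s‖ ^ 2) (by positivity) ?_).trans
      (le_of_eq (by ring))
    filter_upwards [coeFn_val (transL r Φ - transL s Φ - (r - s) • transL s (dtL Φ))] with p hp
    rw [hp]
    simpa [transL_apply] using hpt p.1 p.2 r
  rw [hasDerivAt_iff_isLittleO]
  refine Asymptotics.IsBigO.trans_isLittleO (g := fun r => ‖r - s‖ ^ 2) ?_
    (Asymptotics.isLittleO_pow_sub_sub s one_lt_two)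
  refine Asymptotics.IsBigO.of_bound
    (C * (measureUnivNNReal P.measQ : ℝ) ^ ((2 : ENNReal).toReal)⁻¹)
    (Eventually.of_forall fun r => ?_)
  rw [norm_pow, norm_norm]
  exact hnorm r

/-- Translation in time is continuous at `0` in the energy norm. -/
lemma tendsto_testTriple_transL (hn : 1 ≤ n) (hP : P.Admissible) (Φ : P.testSpace) :
    Tendsto (fun s => testTriple (transL s Φ)) (𝓝 0) (𝓝 (testTriple Φ)) := by
  obtain ⟨C, hC, hle⟩ := exists_norm_testTriple_le hn hP
  rw [tendsto_iff_norm_sub_tendsto_zero]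
  have h1 : ∀ i, Tendsto (fun s => ‖val (dxL i (transL s Φ - Φ))‖ ^ 2) (𝓝 0) (𝓝 0) := by
    intro i
    have := (hasDerivAt_val_transL hP (dxL i Φ) 0).continuousAt.tendsto
    rw [transL_zero, tendsto_iff_norm_sub_tendsto_zero] at this
    simpa [dirDeriv_transL] using this.pow 2
  have h2 : Tendsto (fun s => C * ∑ i, ‖val (dxL i (transL s Φ - Φ))‖ ^ 2) (𝓝 0) (𝓝 0) := by
    simpa using (tendsto_finsetSum Finset.univ fun i _ => h1 i).const_mul C
  have h3 : Tendsto (fun s => ‖testTriple (transL s Φ) - testTriple Φ‖ ^ 2) (𝓝 0) (𝓝 0) := by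
    refine squeeze_zero (fun _ => sq_nonneg _) (fun s => ?_) h2
    rw [← map_sub]
    exact hle _
  simpa using h3.sqrt

lemma exists_norm_testTriple_transL_le (hn : 1 ≤ n) (hP : P.Admissible) :
    ∃ C, 0 ≤ C ∧ ∀ (Φ : P.testSpace) (s : ℝ),
      (∀ p, p.2 ∉ Ioo 0 P.T → (Φ : SpaceTime n → ℝ) p = 0) →
      (∀ i p, p.2 ∉ Ioo 0 P.T → (dxL i Φ : SpaceTime n → ℝ) p = 0) →
      ‖testTriple (transL s Φ)‖ ≤ C * ‖testTriple Φ‖ := by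
  obtain ⟨C, hC, hle⟩ := exists_norm_testTriple_le hn hP
  refine ⟨√C, Real.sqrt_nonneg _, fun Φ s h0 h1 => ?_⟩
  refine le_of_sq_le_sq ?_ (by positivity)
  rw [mul_pow, Real.sq_sqrt hC.le]
  refine (hle _).trans (mul_le_mul_of_nonneg_left ?_ hC.le)
  rw [norm_triple_sq (testTriple Φ)]
  have : ∑ i, ‖val (dxL i (transL s Φ))‖ ^ 2 ≤ ∑ i, ‖gradL i (testTriple Φ)‖ ^ 2 := by
    refine Finset.sum_le_sum fun i _ => ?_
    rw [dirDeriv_transL, gradL_testTriple]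
    exact pow_le_pow_left₀ (norm_nonneg _) (norm_val_transL_le _ (h1 i)) 2
  nlinarith [sq_nonneg ‖fnL (testTriple Φ)‖, sq_nonneg ‖traceL (testTriple Φ)‖]

variable (P) in
/-- The test functions whose support lies in the times `I`. -/
def testsIn (I : Set ℝ) : Submodule ℝ P.testSpace where
  carrier := {Φ | ∀ p ∈ tsupport (Φ : SpaceTime n → ℝ), p.2 ∈ I}
  add_mem' := fun {f g} hf hg p hp => (tsupport_add (f : SpaceTime n → ℝ) g hp).elim (hf p) (hg p)
  zero_mem' := fun p hp => by simp [tsupport] at hp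
  smul_mem' := fun c f hf p hp =>
    hf p (tsupport_smul_subset_right (fun _ => c) (f : SpaceTime n → ℝ) hp)

lemma eq_zero_of_testsIn {I : Set ℝ} {Φ : P.testSpace} (hΦ : Φ ∈ P.testsIn I) {p : SpaceTime n}
    (hp : p.2 ∉ I) : (Φ : SpaceTime n → ℝ) p = 0 :=
  image_eq_zero_of_notMem_tsupport fun h => hp (hΦ p h)

lemma dirDeriv_mem_testsIn {I : Set ℝ} {Φ : P.testSpace} (hΦ : Φ ∈ P.testsIn I) (v : SpaceTime n) :
    dirDeriv v Φ ∈ P.testsIn I := fun p hp => hΦ p (tsupport_fderiv_apply_subset ℝ v hp)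

/-- Test functions with support in `0 < t < T` are dense in the energy space. -/
lemma exists_seq_testsIn (hn : 1 ≤ n) (hP : P.Admissible) {x : P.Triple} (hx : x ∈ P.energySpace) :
    ∃ Φ : ℕ → P.testSpace, (∀ k, Φ k ∈ P.testsIn (Ioo 0 P.T)) ∧
      Tendsto (fun k => testTriple (Φ k)) atTop (𝓝 x) := by
  obtain ⟨C, hC, hle⟩ := exists_norm_testTriple_le hn hP
  have hT := hP.T_pos
  suffices h : P.energySpace ≤ ((P.testsIn (Ioo 0 P.T)).map testTriple).topologicalClosure by
    have hx' := h hx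
    rw [← SetLike.mem_coe, Submodule.topologicalClosure_coe] at hx'
    obtain ⟨y, hy, hlim⟩ := mem_closure_iff_seq_limit.1 hx'
    choose Φ hΦ hΦ' using hy
    exact ⟨Φ, hΦ, by simpa [hΦ'] using hlim⟩
  refine Submodule.topologicalClosure_minimal _ ?_ (Submodule.isClosed_topologicalClosure _)
  rintro - ⟨Φ, rfl⟩
  have hpos : ∀ k : ℕ, (0 : ℝ) < 1 / (k + 3) := fun k => by positivity
  have hlt : ∀ k : ℕ, (1 : ℝ) / (k + 3) < 1 / 2 := fun k =>
    one_div_lt_one_div_of_lt two_pos (by have : (0 : ℝ) ≤ k := k.cast_nonneg; linarith)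
  let θ : ∀ k : ℕ, ContDiffBump (P.T / 2) := fun k =>
    { rIn := P.T / 2 - P.T * (1 / (k + 3))
      rOut := P.T / 2 - P.T * (1 / (k + 3)) / 2
      rIn_pos := by nlinarith [hlt k]
      rIn_lt_rOut := by nlinarith [hpos k, mul_pos hT (hpos k)] }
  have hθs : ∀ k, ContDiff ℝ ((⊤ : ℕ∞) : WithTop ℕ∞) (θ k) := fun k => (θ k).contDiff
  rw [← SetLike.mem_coe, Submodule.topologicalClosure_coe]
  refine mem_closure_of_tendsto (f := fun k : ℕ => testTriple (mulTime (hθs k) Φ)) (b := atTop) ?_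
    (Eventually.of_forall fun k => ⟨_, ?_, rfl⟩)
  · rw [tendsto_iff_norm_sub_tendsto_zero]
    have h1 : ∀ Ψ : P.testSpace,
        Tendsto (fun k => ‖val (mulTime (hθs k) Ψ - Ψ)‖ ^ 2) atTop (𝓝 0) := by
      intro Ψ
      simp only [norm_val_sq]
      have hz : (0 : ℝ) = ∫ p, 0 ∂P.measQ := by simp
      rw [hz]
      refine tendsto_integral_of_dominated_convergence (fun p => (Ψ : SpaceTime n → ℝ) p ^ 2)
        (fun k => ((memLp_test _).integrable_sq).aestronglyMeasurable)
        (memLp_test Ψ).integrable_sq (fun k => Eventually.of_forall fun p => ?_) ?_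
      · have e : (mulTime (hθs k) Ψ - Ψ : P.testSpace).1 p
            = (θ k p.2 - 1) * (Ψ : SpaceTime n → ℝ) p := by
          simp [mulTime]; ring
        rw [e, mul_pow, Real.norm_eq_abs, abs_of_nonneg (by positivity)]
        have h0 := (θ k).nonneg (x := p.2)
        have h1 := (θ k).le_one (x := p.2)
        have : (θ k p.2 - 1) ^ 2 ≤ 1 := by nlinarith
        nlinarith [sq_nonneg ((Ψ : SpaceTime n → ℝ) p)]
      · filter_upwards [ae_mem_measQ hP] with p hp
        obtain ⟨-, h0, h1⟩ := hp
        have hlim : Tendsto (fun k : ℕ => P.T * (1 / ((k : ℝ) + 3))) atTop (𝓝 0) := by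
          have h3 : Tendsto (fun k : ℕ => (k : ℝ) + 3) atTop atTop :=
            tendsto_atTop_add_const_right _ _ tendsto_natCast_atTop_atTop
          simpa using (tendsto_inv_atTop_zero.comp h3).const_mul P.T
        have hev : ∀ᶠ k : ℕ in atTop, P.T * (1 / ((k : ℝ) + 3)) < min p.2 (P.T - p.2) :=
          hlim.eventually_lt_const (lt_min h0 (by linarith))
        refine tendsto_const_nhds.congr' ?_
        filter_upwards [hev] with k hk
        have hone : θ k p.2 = 1 := by
          refine (θ k).one_of_mem_closedBall ?_
          rw [Metric.mem_closedBall, Real.dist_eq, abs_le]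
          obtain ⟨ha, hb⟩ := lt_min_iff.1 hk
          simp only [θ]
          constructor <;> linarith
        simp [mulTime, hone]
    have h2 : Tendsto (fun k => C * ∑ i, ‖val (dxL i (mulTime (hθs k) Φ - Φ))‖ ^ 2) atTop
        (𝓝 0) := by
      simp only [map_sub, dxL_mulTime]
      simpa using (tendsto_finsetSum Finset.univ fun i _ => h1 (dxL i Φ)).const_mul C
    have h3 : Tendsto (fun k => ‖testTriple (mulTime (hθs k) Φ) - testTriple Φ‖ ^ 2) atTop
        (𝓝 0) := by
      refine squeeze_zero (fun _ => sq_nonneg _) (fun s => ?_) h2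
      rw [← map_sub]
      exact hle _
    simpa using h3.sqrt
  · intro p hp
    have h1 : p.2 ∈ tsupport (θ k) := by
      have h0 := tsupport_mul_subset_left (f := fun p : SpaceTime n => θ k p.2)
        (g := (Φ : SpaceTime n → ℝ)) hp
      exact tsupport_comp_subset_preimage (θ k) (f := fun p : SpaceTime n => p.2) (by fun_prop) h0
    rw [(θ k).tsupport_eq, Metric.mem_closedBall, Real.dist_eq, abs_le] at h1
    simp only [θ] at h1
    have := mul_pos hT (hpos k)
    constructor <;> linarith [h1.1, h1.2]

end Problem
lemma abs_entry_le_of_elliptic {d : ℕ} {A : Matrix (Fin d) (Fin d) ℝ} (hA : A.IsSymm) {c : ℝ}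
    (hc : 0 < c) (h : ∀ ξ : Fin d → ℝ, c * ∑ i, ξ i ^ 2 ≤ ∑ i, ∑ j, A i j * ξ j * ξ i ∧
      ∑ i, ∑ j, A i j * ξ j * ξ i ≤ c⁻¹ * ∑ i, ξ i ^ 2) (i j : Fin d) : |A i j| ≤ 2 * c⁻¹ := by
  have hone : ∀ i : Fin d, ∑ k, (Pi.single i (1 : ℝ) : Fin d → ℝ) k ^ 2 = 1 := by
    intro i
    rw [Finset.sum_eq_single i] <;> simp +contextual
  have hent : ∀ i j : Fin d, ∑ k, ∑ l, A k l * (Pi.single j (1 : ℝ) : Fin d → ℝ) l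
      * (Pi.single i (1 : ℝ) : Fin d → ℝ) k = A i j := by
    intro i j
    simp [Pi.single_apply]
  have hd : ∀ i, 0 ≤ A i i ∧ A i i ≤ c⁻¹ := by
    intro i
    obtain ⟨h1, h2⟩ := h (Pi.single i 1)
    rw [hone, hent] at h1 h2
    constructor <;> linarith
  obtain ⟨h1, h2⟩ := h (Pi.single i 1 + Pi.single j 1)
  have e : ∑ k, ∑ l, A k l * (Pi.single i 1 + Pi.single j 1 : Fin d → ℝ) l
      * (Pi.single i 1 + Pi.single j 1 : Fin d → ℝ) k = A i i + A j j + 2 * A i j := by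
    have hs : A j i = A i j := hA.apply i j
    rw [show A i i + A j j + 2 * A i j = A i i + A i j + (A j i + A j j) by rw [hs]; ring,
      ← hent i i, ← hent i j, ← hent j i, ← hent j j]
    simp only [← Finset.sum_add_distrib]
    refine Finset.sum_congr rfl fun k _ => Finset.sum_congr rfl fun l _ => ?_
    simp only [Pi.add_apply]
    ring
  have hsq : ∑ k, (Pi.single i 1 + Pi.single j 1 : Fin d → ℝ) k ^ 2 ≤ 4 := by
    calc ∑ k, (Pi.single i 1 + Pi.single j 1 : Fin d → ℝ) k ^ 2
        ≤ ∑ k, (2 * (Pi.single i (1 : ℝ) : Fin d → ℝ) k ^ 2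
          + 2 * (Pi.single j (1 : ℝ) : Fin d → ℝ) k ^ 2) := by
          refine Finset.sum_le_sum fun k _ => ?_
          simp only [Pi.add_apply]
          nlinarith [sq_nonneg ((Pi.single i (1 : ℝ) : Fin d → ℝ) k
            - (Pi.single j (1 : ℝ) : Fin d → ℝ) k)]
      _ = 4 := by
          rw [Finset.sum_add_distrib, ← Finset.mul_sum, ← Finset.mul_sum, hone, hone]
          norm_num
  have hsq0 : 0 ≤ ∑ k, (Pi.single i 1 + Pi.single j 1 : Fin d → ℝ) k ^ 2 :=
    Finset.sum_nonneg fun _ _ => sq_nonneg _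
  rw [e] at h1 h2
  have hci : 0 < c⁻¹ := inv_pos.2 hc
  have h3 : c⁻¹ * ∑ k, (Pi.single i 1 + Pi.single j 1 : Fin d → ℝ) k ^ 2 ≤ c⁻¹ * 4 := by gcongr
  have h4 : 0 ≤ c * ∑ k, (Pi.single i 1 + Pi.single j 1 : Fin d → ℝ) k ^ 2 := by positivity
  rw [abs_le]
  constructor <;> linarith [hd i, hd j, (hd i).1, (hd i).2, (hd j).1, (hd j).2]

namespace Problem

variable {n : ℕ} {P : Problem n}

lemma memLp_a (hP : P.Admissible) (i j : Fin (n + 1)) : MemLp (fun p => P.a p i j) ⊤ P.measQ := by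
  obtain ⟨c, hc, -, h⟩ := hP.a_elliptic
  refine memLp_top_of_bound (hP.a_meas i j) (2 * c⁻¹) ?_
  filter_upwards [h, hP.a_symm] with p h1 h2
  exact abs_entry_le_of_elliptic h2 hc h1 i j

/-- The form of the elliptic operator on triples. -/
noncomputable def energyForm (hP : P.Admissible) : P.Triple →L[ℝ] P.Triple →L[ℝ] ℝ :=
  (∑ i, ∑ j, (innerBilin P.L2Q).bilinearComp ((mulL (memLp_a hP i j)).comp (gradL j)) (gradL i))
    + (innerBilin P.L2Q).bilinearComp ((mulL hP.q_bdd).comp fnL) fnL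

lemma energyForm_apply (hP : P.Admissible) (x y : P.Triple) :
    Integrable (fun p => (∑ i, ∑ j, P.a p i j * gradL j x p * gradL i y p)
      + P.q p * fnL x p * fnL y p) P.measQ ∧
    energyForm hP x y = ∫ p, ((∑ i, ∑ j, P.a p i j * gradL j x p * gradL i y p)
      + P.q p * fnL x p * fnL y p) ∂P.measQ := by
  have h1 : ∀ i j, Integrable (fun p => P.a p i j * gradL j x p * gradL i y p) P.measQ :=
    fun i j => integrable_mulL_mul (memLp_a hP i j) (gradL j x) (gradL i y)
  have h2 : Integrable (fun p => P.q p * fnL x p * fnL y p) P.measQ :=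
    integrable_mulL_mul hP.q_bdd (fnL x) (fnL y)
  have h3 : Integrable (fun p => ∑ i, ∑ j, P.a p i j * gradL j x p * gradL i y p) P.measQ :=
    integrable_finsetSum _ fun i _ => integrable_finsetSum _ fun j _ => h1 i j
  refine ⟨h3.add h2, ?_⟩
  rw [integral_add h3 h2, integral_finsetSum _ fun i _ => integrable_finsetSum _ fun j _ => h1 i j]
  simp only [integral_finsetSum _ fun j _ => h1 _ j]
  simp only [energyForm, add_apply, sum_apply,
    ContinuousLinearMap.bilinearComp_apply, ContinuousLinearMap.comp_apply, innerBilin_apply,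
    inner_mulL]

lemma energyForm_symm (hP : P.Admissible) (x y : P.Triple) :
    energyForm hP x y = energyForm hP y x := by
  rw [(energyForm_apply hP x y).2, (energyForm_apply hP y x).2]
  refine integral_congr_ae ?_
  filter_upwards [hP.a_symm] with p hp
  rw [Finset.sum_comm]
  congr 1
  · refine Finset.sum_congr rfl fun i _ => Finset.sum_congr rfl fun j _ => ?_
    rw [hp.apply i j]
    ring
  · ring

lemma energyForm_coercive (hP : P.Admissible) :
    ∃ c > 0, ∀ x : P.Triple, c * ∑ i, ‖gradL i x‖ ^ 2 ≤ energyForm hP x x := by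
  obtain ⟨c, hc, -, h⟩ := hP.a_elliptic
  refine ⟨c, hc, fun x => ?_⟩
  obtain ⟨hI, he⟩ := energyForm_apply hP x x
  have hi : ∀ i, Integrable (fun p => gradL i x p ^ 2) P.measQ := fun i =>
    (Lp.memLp (gradL i x)).integrable_sq
  have e : c * ∑ i, ‖gradL i x‖ ^ 2 = ∫ p, c * ∑ i, gradL i x p ^ 2 ∂P.measQ := by
    rw [integral_const_mul, integral_finsetSum _ fun i _ => hi i]
    simp only [integral_sq_eq_norm_sq]
  rw [e, he]
  refine integral_mono_ae ((integrable_finsetSum _ fun i _ => hi i).const_mul c) hI ?_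
  filter_upwards [h, hP.q_nonneg] with p h1 h2
  have h3 := (h1 fun i => gradL i x p).1
  have h4 : 0 ≤ P.q p * fnL x p * fnL x p := by
    rw [mul_assoc]; exact mul_nonneg h2 (mul_self_nonneg _)
  linarith

lemma energyForm_testTriple (hP : P.Admissible) (x : P.Triple) (Φ : P.testSpace) :
    energyForm hP x (testTriple Φ) = P.form (fnL x) (fun i => gradL i x) Φ := by
  rw [(energyForm_apply hP x _).2, form]
  refine integral_congr_ae ?_
  have h1 : ∀ᵐ p ∂P.measQ, ∀ i, val (dxL i Φ) p = dx i Φ p :=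
    ae_all_iff.2 fun i => coeFn_val (dxL i Φ)
  filter_upwards [h1, coeFn_val Φ] with p h1 h2
  simp only [gradL_testTriple, fnL_testTriple, h1, h2]

/-- The pairing of the fractional integral. -/
noncomputable def frac (hP : P.Admissible) : P.L2Q →L[ℝ] P.L2Q →L[ℝ] ℝ :=
  fracForm P.measQ_eq (β := 1 - P.α) (sub_pos.2 hP.α_lt_one) hP.T_pos.le

lemma ae_eq_prod {w w' : SpaceTime n → ℝ} (h : w =ᵐ[P.measQ] w') :
    w =ᵐ[P.measΩ.prod (volume.restrict (Ioo 0 P.T))] w' := by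
  rwa [measQ_eq] at h

lemma frac_eq_fracInt (hP : P.Admissible) {u z : P.L2Q} {w y : SpaceTime n → ℝ}
    (hu : u =ᵐ[P.measQ] w) (hz : z =ᵐ[P.measQ] y) :
    frac hP u z = fracInt P.measΩ (1 - P.α) P.T w y :=
  fracInt_congr (ae_eq_prod hu) (ae_eq_prod hz)

lemma memLp_prod {w : SpaceTime n → ℝ} (hw : MemLp w 2 P.measQ) :
    MemLp w 2 (P.measΩ.prod (volume.restrict (Ioo 0 P.T))) := by
  rwa [measQ_eq] at hw

lemma integral_leftFracInt_dt (hP : P.Admissible) (u : P.L2Q) (Φ : P.testSpace) :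
    ∫ p, leftFracInt (1 - P.α) (fun s => u (p.1, s)) p.2 * dt (Φ : SpaceTime n → ℝ) p ∂P.measQ
      = frac hP u (val (dtL Φ)) := by
  have h1 := Lp.memLp u
  have h2 := memLp_test (dtL Φ)
  rw [frac_eq_fracInt hP (ae_eq_refl _) (coeFn_val (dtL Φ)),
    ← integral_leftFracInt_mul (sub_pos.2 hP.α_lt_one) hP.T_pos.le (memLp_prod h1) (memLp_prod h2)]
  generalize (u : SpaceTime n → ℝ) = w
  rw [measQ_eq]
  rfl

lemma integral_rightFracInt_dt (hP : P.Admissible) (v : P.L2Q) (Φ : P.testSpace) :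
    ∫ p, rightFracInt (1 - P.α) P.T (fun s => v (p.1, s)) p.2 * dt (Φ : SpaceTime n → ℝ) p ∂P.measQ
      = frac hP (val (dtL Φ)) v := by
  have h1 := Lp.memLp v
  have h2 := memLp_test (dtL Φ)
  rw [frac_eq_fracInt hP (coeFn_val (dtL Φ)) (ae_eq_refl _),
    ← integral_rightFracInt_mul (sub_pos.2 hP.α_lt_one) hP.T_pos.le (memLp_prod h2)
      (memLp_prod h1)]
  generalize (v : SpaceTime n → ℝ) = w
  rw [measQ_eq]
  rfl

lemma frac_translate (hP : P.Admissible) {η χ : P.testSpace} (hη : η ∈ P.testsIn (Ioo 0 P.T))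
    (hχ : χ ∈ P.testsIn (Ioo 0 P.T)) {h : ℝ} (hh : 0 ≤ h) :
    frac hP (val η) (val (transL h χ)) = frac hP (val (transL (-h) η)) (val χ) := by
  have e1 : (transL h χ : SpaceTime n → ℝ) = fun p => (χ : SpaceTime n → ℝ) (p.1, p.2 + h) :=
    funext fun p => transL_apply _ _ _
  have e2 : (transL (-h) η : SpaceTime n → ℝ) = fun p => (η : SpaceTime n → ℝ) (p.1, p.2 - h) :=
    funext fun p => transL_apply _ _ _
  have m1 := memLp_test (transL h χ)
  have m2 := memLp_test (transL (-h) η)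
  rw [frac_eq_fracInt hP (coeFn_val _) (coeFn_val _), frac_eq_fracInt hP (coeFn_val _)
    (coeFn_val _), e1, e2]
  rw [e1] at m1
  rw [e2] at m2
  exact fracInt_translate (sub_pos.2 hP.α_lt_one) hP.T_pos.le hh (memLp_prod (memLp_test η))
    (memLp_prod (memLp_test χ)) (memLp_prod m2) (memLp_prod m1)
    (fun p hp => eq_zero_of_testsIn hη hp) (fun p hp => eq_zero_of_testsIn hχ hp)

lemma frac_deriv_nonpos (hP : P.Admissible) {Φ : P.testSpace} (hΦ : Φ ∈ P.testsIn (Iio P.T)) :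
    frac hP (val Φ) (val (dtL Φ)) ≤ 0 := by
  rw [frac_eq_fracInt hP (coeFn_val _) (coeFn_val _)]
  exact fracInt_deriv_nonpos (sub_pos.2 hP.α_lt_one) (by linarith [hP.α_pos]) hP.T_pos
    (memLp_prod (memLp_test Φ)) (memLp_prod (memLp_test _)) (hasDerivAt_time Φ)
    (fun x => (continuous_test (dtL Φ)).comp (by fun_prop))
    (fun x => eq_zero_of_testsIn hΦ (by simp))

lemma frac_deriv_nonneg (hP : P.Admissible) {Φ : P.testSpace} (hΦ : Φ ∈ P.testsIn (Ioi 0)) :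
    0 ≤ frac hP (val (dtL Φ)) (val Φ) := by
  rw [frac_eq_fracInt hP (coeFn_val _) (coeFn_val _)]
  exact fracInt_deriv_nonneg (sub_pos.2 hP.α_lt_one) (by linarith [hP.α_pos]) hP.T_pos
    (memLp_prod (memLp_test Φ)) (memLp_prod (memLp_test _)) (hasDerivAt_time Φ)
    (fun x => (continuous_test (dtL Φ)).comp (by fun_prop))
    (fun x => eq_zero_of_testsIn hΦ (by simp))

/-- The weak form of the direct problem with a general right-hand side. -/
def DirectWeak (hP : P.Admissible) (L : P.Triple →L[ℝ] ℝ) (x : P.Triple) : Prop :=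
  ∀ Φ ∈ P.testsIn (Iio P.T),
    -frac hP (fnL x) (val (dtL Φ)) + energyForm hP x (testTriple Φ) = L (testTriple Φ)

/-- The weak form of the adjoint problem with a general right-hand side. -/
def AdjointWeak (hP : P.Admissible) (L : P.Triple →L[ℝ] ℝ) (x : P.Triple) : Prop :=
  ∀ Φ ∈ P.testsIn (Ioi 0),
    frac hP (val (dtL Φ)) (fnL x) + energyForm hP x (testTriple Φ) = L (testTriple Φ)

lemma exists_weak_aux (hn : 1 ≤ n) (hP : P.Admissible) (S : Submodule ℝ P.testSpace)
    (B : P.testSpace →ₗ[ℝ] P.Triple →L[ℝ] ℝ) (hB : ∀ Φ ∈ S, 0 ≤ B Φ (testTriple Φ))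
    (L : P.Triple →L[ℝ] ℝ) : ∃ x ∈ P.energySpace, ∀ Φ ∈ S,
      B Φ x + energyForm hP x (testTriple Φ) = L (testTriple Φ) := by
  obtain ⟨C, hC, hle⟩ := exists_norm_testTriple_le hn hP
  obtain ⟨c, hc, hco⟩ := energyForm_coercive hP
  obtain ⟨x, hx, h⟩ := exists_mem_forall_eq_of_coercive P.energySpace isClosed_energySpace
    (testTriple ∘ₗ S.subtype) (fun m => testTriple_mem _)
    ((B + ((energyForm hP).flip : P.Triple →ₗ[ℝ] P.Triple →L[ℝ] ℝ) ∘ₗ testTriple) ∘ₗ S.subtype)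
    (c := c / C) (by positivity) (fun Φ : S => by
      have h1 := hB Φ Φ.2
      have h2 := hco (testTriple (Φ : P.testSpace))
      have h3 := hle (Φ : P.testSpace)
      simp only [gradL_testTriple] at h2
      have h4 : c / C * ‖testTriple (Φ : P.testSpace)‖ ^ 2
          ≤ c * ∑ i, ‖val (dxL i (Φ : P.testSpace))‖ ^ 2 := by
        rw [div_mul_eq_mul_div, div_le_iff₀ hC]
        nlinarith
      exact h4.trans (h2.trans (le_add_of_nonneg_left h1))) L
  exact ⟨x, hx, fun Φ hΦ => h ⟨Φ, hΦ⟩⟩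

lemma exists_directWeak (hn : 1 ≤ n) (hP : P.Admissible) (L : P.Triple →L[ℝ] ℝ) :
    ∃ x ∈ P.energySpace, DirectWeak hP L x :=
  exists_weak_aux hn hP (P.testsIn (Iio P.T))
    { toFun := fun Φ => -((frac hP).flip (val (dtL Φ))).comp fnL
      map_add' := fun a b => by ext; simp; ring
      map_smul' := fun a b => by ext; simp }
    (fun Φ hΦ => by simpa using frac_deriv_nonpos hP hΦ) L

lemma exists_adjointWeak (hn : 1 ≤ n) (hP : P.Admissible) (L : P.Triple →L[ℝ] ℝ) :
    ∃ x ∈ P.energySpace, AdjointWeak hP L x :=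
  exists_weak_aux hn hP (P.testsIn (Ioi 0))
    { toFun := fun Φ => (frac hP (val (dtL Φ))).comp fnL
      map_add' := fun a b => by ext; simp
      map_smul' := fun a b => by ext; simp }
    (fun Φ hΦ => by simpa using frac_deriv_nonneg hP hΦ) L

lemma transL_mem_testsIn_Iio {Φ : P.testSpace} (hΦ : Φ ∈ P.testsIn (Ioo 0 P.T)) {s : ℝ}
    (hs : 0 ≤ s) : transL s Φ ∈ P.testsIn (Iio P.T) := fun p hp => by
  have := (hΦ _ (tsupport_transL s Φ hp)).2
  simp only [mem_Iio] at this ⊢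
  linarith

lemma transL_neg_mem_testsIn_Ioi {Φ : P.testSpace} (hΦ : Φ ∈ P.testsIn (Ioo 0 P.T)) {s : ℝ}
    (hs : 0 ≤ s) : transL (-s) Φ ∈ P.testsIn (Ioi 0) := fun p hp => by
  have := (hΦ _ (tsupport_transL (-s) Φ hp)).1
  simp only [mem_Ioi] at this ⊢
  linarith

/-- Small time translations of a convergent sequence of test functions stay near its limit. -/
lemma eventually_norm_transL_sub_le (hn : 1 ≤ n) (hP : P.Admissible) {χ : ℕ → P.testSpace}
    (hχ : ∀ k, χ k ∈ P.testsIn (Ioo 0 P.T)) {y : P.Triple}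
    (hlim : Tendsto (fun k => testTriple (χ k)) atTop (𝓝 y)) {ε : ℝ} (hε : 0 < ε) :
    ∃ h₀ > 0, ∀ᶠ k in atTop, ∀ s, |s| ≤ h₀ → ‖testTriple (transL s (χ k)) - y‖ ≤ ε := by
  obtain ⟨C, hC, hle⟩ := exists_norm_testTriple_transL_le (P := P) hn hP
  set δ := ε / (2 * C + 2) with hδ
  have hδ0 : 0 < δ := by positivity
  obtain ⟨N, hN⟩ := Metric.tendsto_atTop.1 hlim δ hδ0
  obtain ⟨r, hr, hcont⟩ := Metric.tendsto_nhds_nhds.1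
    (tendsto_testTriple_transL hn hP (χ N)) δ hδ0
  refine ⟨r / 2, by positivity, eventually_atTop.2 ⟨N, fun k hk s hs => ?_⟩⟩
  have h1 : ‖testTriple (transL s (χ k)) - testTriple (transL s (χ N))‖ ≤ C * (2 * δ) := by
    rw [← map_sub, ← map_sub]
    have hmem := (P.testsIn (Ioo 0 P.T)).sub_mem (hχ k) (hχ N)
    refine (hle _ s (fun p hp => eq_zero_of_testsIn hmem hp)
      (fun i p hp => eq_zero_of_testsIn (dirDeriv_mem_testsIn hmem _) hp)).trans ?_
    gcongr
    rw [map_sub, ← dist_eq_norm]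
    calc _ ≤ dist (testTriple (χ k)) y + dist (testTriple (χ N)) y := dist_triangle_right _ _ _
      _ ≤ _ := by linarith [hN k hk, hN N le_rfl]
  have h2 : ‖testTriple (transL s (χ N)) - testTriple (χ N)‖ ≤ δ := by
    rw [← dist_eq_norm]
    refine (hcont ?_).le
    rw [Real.dist_eq, sub_zero]
    linarith
  have h3 : ‖testTriple (χ N) - y‖ ≤ δ := by
    rw [← dist_eq_norm]
    exact (hN N le_rfl).le
  calc ‖testTriple (transL s (χ k)) - y‖
      = ‖(testTriple (transL s (χ k)) - testTriple (transL s (χ N)))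
        + (testTriple (transL s (χ N)) - testTriple (χ N)) + (testTriple (χ N) - y)‖ := by
        congr 1; abel
    _ ≤ C * (2 * δ) + δ + δ := (norm_add₃_le).trans (by linarith)
    _ = ε := by rw [hδ]; field_simp; ring

lemma abs_increment_le {g g' : ℝ → ℝ} (hg : ∀ s, HasDerivAt g (g' s) s) {a D h : ℝ} (hh : 0 ≤ h)
    (hD : ∀ s, 0 ≤ s → s ≤ h → |g' s - a| ≤ D) : |g h - g 0 - h * a| ≤ D * h := by
  have := (convex_Icc 0 h).norm_image_sub_le_of_norm_hasDerivWithin_le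
    (f := fun s => g s - s * a) (f' := fun s => g' s - a) (C := D)
    (fun s _ => (((hg s).sub ((hasDerivAt_id s).mul_const a)).congr_deriv
      (by simp)).hasDerivWithinAt)
    (fun s hs => hD s hs.1 hs.2) (left_mem_Icc.2 hh) (right_mem_Icc.2 hh)
  simp only [sub_zero, Real.norm_eq_abs, abs_of_nonneg hh, zero_mul] at this
  rwa [show g h - g 0 - h * a = g h - h * a - g 0 by ring]

/-- The fractional derivative and its adjoint are in duality on weak solutions. -/
lemma frac_duality (hn : 1 ≤ n) (hP : P.Admissible) {x y : P.Triple} (hx : x ∈ P.energySpace)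
    (hy : y ∈ P.energySpace) {F F' : P.Triple →L[ℝ] ℝ}
    (hF : ∀ Φ ∈ P.testsIn (Iio P.T), -frac hP (fnL x) (val (dtL Φ)) = F (testTriple Φ))
    (hF' : ∀ Φ ∈ P.testsIn (Ioi 0), frac hP (val (dtL Φ)) (fnL y) = F' (testTriple Φ)) :
    F y = F' x := by
  obtain ⟨χ, hχ, hχy⟩ := exists_seq_testsIn hn hP hy
  obtain ⟨η, hη, hηx⟩ := exists_seq_testsIn hn hP hx
  have hB : ∀ h, 0 ≤ h → Tendsto (fun k => frac hP (fnL x) (val (transL h (χ k)))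
      - frac hP (val (transL (-h) (η k))) (fnL y)) atTop (𝓝 0) := by
    intro h hh
    have hu : Tendsto (fun k => val (χ k)) atTop (𝓝 (fnL y)) :=
      (fnL.continuous.tendsto y).comp hχy
    have hv : Tendsto (fun k => val (η k)) atTop (𝓝 (fnL x)) :=
      (fnL.continuous.tendsto x).comp hηx
    have hb : Tendsto (fun k => ‖frac hP‖ * (‖fnL x - val (η k)‖ * ‖val (χ k)‖
        + ‖val (η k)‖ * ‖fnL y - val (χ k)‖)) atTop (𝓝 0) := by
      have h1 := (tendsto_const_nhds (x := fnL x)).sub hv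
      have h2 := (tendsto_const_nhds (x := fnL y)).sub hu
      have := ((h1.norm.mul hu.norm).add (hv.norm.mul h2.norm)).const_mul ‖frac hP‖
      simpa using this
    refine squeeze_zero_norm (fun k => ?_) hb
    have e : frac hP (fnL x) (val (transL h (χ k))) - frac hP (val (transL (-h) (η k))) (fnL y)
        = frac hP (fnL x - val (η k)) (val (transL h (χ k)))
          - frac hP (val (transL (-h) (η k))) (fnL y - val (χ k)) := by
      have := frac_translate hP (hη k) (hχ k) hh
      simp only [map_sub, sub_apply]
      linarith
    have n1 := norm_val_transL_le (s := h) (χ k) fun p hp => eq_zero_of_testsIn (hχ k) hp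
    have n2 := norm_val_transL_le (s := -h) (η k) fun p hp => eq_zero_of_testsIn (hη k) hp
    rw [e]
    calc _ ≤ ‖frac hP (fnL x - val (η k)) (val (transL h (χ k)))‖
          + ‖frac hP (val (transL (-h) (η k))) (fnL y - val (χ k))‖ := norm_sub_le _ _
      _ ≤ ‖frac hP‖ * ‖fnL x - val (η k)‖ * ‖val (χ k)‖
          + ‖frac hP‖ * ‖val (η k)‖ * ‖fnL y - val (χ k)‖ := by
          refine add_le_add (((frac hP).le_opNorm₂ _ _).trans ?_)
            (((frac hP).le_opNorm₂ _ _).trans ?_) <;> gcongr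
      _ = _ := by ring
  have hmain : ∀ ε > 0, |F y - F' x| ≤ (‖F‖ + ‖F'‖) * ε := by
    intro ε hε
    obtain ⟨h₁, hh₁, e₁⟩ := eventually_norm_transL_sub_le hn hP hχ hχy hε
    obtain ⟨h₂, hh₂, e₂⟩ := eventually_norm_transL_sub_le hn hP hη hηx hε
    set h := min h₁ h₂
    have hh : 0 < h := lt_min hh₁ hh₂
    have hlim := (((hB h hh.le).sub (hB 0 le_rfl)).abs).const_add ((‖F‖ + ‖F'‖) * ε * h)
    simp only [sub_zero, abs_zero, add_zero] at hlim
    have hfin : h * |F y - F' x| ≤ (‖F‖ + ‖F'‖) * ε * h := by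
      refine ge_of_tendsto hlim ?_
      filter_upwards [e₁, e₂] with k k1 k2
      have g1 := abs_increment_le
        (g := fun s => frac hP (fnL x) (val (transL s (χ k))))
        (g' := fun s => frac hP (fnL x) (val (transL s (dtL (χ k)))))
        (a := -F y) (D := ‖F‖ * ε) (h := h)
        (fun s => (frac hP (fnL x)).hasFDerivAt.comp_hasDerivAt s
          (hasDerivAt_val_transL hP (χ k) s)) hh.le (fun s hs0 hs => by
          have := hF _ (transL_mem_testsIn_Iio (hχ k) hs0)
          rw [dirDeriv_transL] at this
          rw [show frac hP (fnL x) (val (transL s (dtL (χ k)))) - -F y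
            = -F (testTriple (transL s (χ k)) - y) by rw [map_sub, ← this]; ring, abs_neg]
          refine (F.le_opNorm _).trans ?_
          gcongr
          exact k1 s (by rw [abs_of_nonneg hs0]; exact hs.trans (min_le_left _ _)))
      have g2 := abs_increment_le
        (g := fun s => frac hP (val (transL (-s) (η k))) (fnL y))
        (g' := fun s => -frac hP (val (transL (-s) (dtL (η k)))) (fnL y))
        (a := -F' x) (D := ‖F'‖ * ε) (h := h)
        (fun s => by
          have h1 : HasDerivAt (fun s => val (transL (-s) (η k)))
              (-val (transL (-s) (dtL (η k)))) s := by
            exact ((hasDerivAt_val_transL hP (η k) (-s)).scomp s (hasDerivAt_neg s)).congr_deriv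
              (by simp)
          exact (((frac hP).flip (fnL y)).hasFDerivAt.comp_hasDerivAt s h1).congr_deriv
            (by simp)) hh.le (fun s hs0 hs => by
          have := hF' _ (transL_neg_mem_testsIn_Ioi (hη k) hs0)
          rw [dirDeriv_transL] at this
          rw [show -frac hP (val (transL (-s) (dtL (η k)))) (fnL y) - -F' x
            = -F' (testTriple (transL (-s) (η k)) - x) by rw [map_sub, ← this]; ring, abs_neg]
          refine (F'.le_opNorm _).trans ?_
          gcongr
          exact k2 (-s) (by rw [abs_neg, abs_of_nonneg hs0]; exact hs.trans (min_le_right _ _)))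
      rw [← abs_of_pos hh, ← abs_mul, abs_of_pos hh]
      simp only [neg_zero] at g2
      rw [abs_le] at g1 g2 ⊢
      have h3 := neg_abs_le (frac hP (fnL x) (val (transL h (χ k)))
        - frac hP (val (transL (-h) (η k))) (fnL y) - (frac hP (fnL x) (val (transL 0 (χ k)))
        - frac hP (val (transL (-0) (η k))) (fnL y)))
      have h4 := le_abs_self (frac hP (fnL x) (val (transL h (χ k)))
        - frac hP (val (transL (-h) (η k))) (fnL y) - (frac hP (fnL x) (val (transL 0 (χ k)))
        - frac hP (val (transL (-0) (η k))) (fnL y)))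
      simp only [neg_zero] at h3 h4 ⊢
      constructor <;> linarith [g1.1, g1.2, g2.1, g2.2]
    by_contra! hcon
    nlinarith
  have : |F y - F' x| ≤ 0 := by
    refine le_of_forall_pos_le_add fun ε hε => ?_
    have h1 := hmain (ε / (‖F‖ + ‖F'‖ + 1)) (by positivity)
    refine h1.trans ?_
    rw [zero_add, mul_div_assoc', div_le_iff₀ (by positivity)]
    nlinarith
  exact sub_eq_zero.1 (abs_eq_zero.1 (le_antisymm this (abs_nonneg _)))

/-- Duality of the direct and the adjoint problem. -/
lemma weak_duality (hn : 1 ≤ n) (hP : P.Admissible) {x y : P.Triple} (hx : x ∈ P.energySpace)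
    (hy : y ∈ P.energySpace) {L L' : P.Triple →L[ℝ] ℝ} (hL : DirectWeak hP L x)
    (hL' : AdjointWeak hP L' y) : L y = L' x := by
  have := frac_duality hn hP hx hy (F := L - energyForm hP x) (F' := L' - energyForm hP y)
    (fun Φ hΦ => by rw [sub_apply, ← hL Φ hΦ]; ring)
    (fun Φ hΦ => by rw [sub_apply, ← hL' Φ hΦ]; ring)
  rw [sub_apply, sub_apply, energyForm_symm hP y x] at this
  linarith

lemma DirectWeak.unique (hn : 1 ≤ n) {hP : P.Admissible} {x y : P.Triple}
    (hx : x ∈ P.energySpace) (hy : y ∈ P.energySpace) {L : P.Triple →L[ℝ] ℝ}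
    (h1 : DirectWeak hP L x) (h2 : DirectWeak hP L y) : x = y := by
  obtain ⟨z, hz, h⟩ := exists_adjointWeak hn hP (innerBilin P.Triple (x - y))
  have e1 := weak_duality hn hP hx hz h1 h
  have e2 := weak_duality hn hP hy hz h2 h
  have : innerBilin P.Triple (x - y) (x - y) = 0 := by rw [map_sub, ← e1, ← e2, sub_self]
  exact sub_eq_zero.1 (inner_self_eq_zero.1 this)

lemma AdjointWeak.unique (hn : 1 ≤ n) {hP : P.Admissible} {x y : P.Triple}
    (hx : x ∈ P.energySpace) (hy : y ∈ P.energySpace) {L : P.Triple →L[ℝ] ℝ}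
    (h1 : AdjointWeak hP L x) (h2 : AdjointWeak hP L y) : x = y := by
  obtain ⟨z, hz, h⟩ := exists_directWeak hn hP (innerBilin P.Triple (x - y))
  have e1 := weak_duality hn hP hz hx h h1
  have e2 := weak_duality hn hP hz hy h h2
  have : innerBilin P.Triple (x - y) (x - y) = 0 := by rw [map_sub, e1, e2, sub_self]
  exact sub_eq_zero.1 (inner_self_eq_zero.1 this)

lemma quasiMeasurePreserving_lateral :
    Measure.QuasiMeasurePreserving (fun p : SpaceTime n => (p.1.1, p.2)) P.measQ P.measS :=
  Measure.quasiMeasurePreserving_fst.comp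
    (measurePreserving_swapRight_measQ (P := P)).quasiMeasurePreserving

lemma memLp_lift (f : P.L2S) : MemLp (fun p : SpaceTime n => f (p.1.1, p.2)) 2 P.measQ :=
  ((Lp.memLp f).comp_fst (volume.restrict (Ioo (-P.ℓ) P.ℓ))).comp_measurePreserving
    measurePreserving_swapRight_measQ

lemma norm_lift_sq (hP : P.Admissible) (f : P.L2S) :
    ‖(memLp_lift f).toLp‖ ^ 2 = 2 * P.ℓ * ‖f‖ ^ 2 := by
  have hℓ := hP.ℓ_pos
  have e : ∫ p, ((memLp_lift f).toLp : P.L2Q) p ^ 2 ∂P.measQ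
      = ∫ p : SpaceTime n, f (p.1.1, p.2) ^ 2 ∂P.measQ := by
    refine integral_congr_ae ?_
    filter_upwards [(memLp_lift f).coeFn_toLp] with p hp
    rw [hp]
  rw [← integral_sq_eq_norm_sq, e, ← integral_sq_eq_norm_sq,
    integral_measQ_eq (memLp_lift f).integrable_sq, ← integral_const_mul]
  congr 1; ext y
  simp only [integral_const, smul_eq_mul, measureReal_restrict_apply_univ, Real.volume_real_Ioo]
  rw [max_eq_left (by linarith)]
  ring

/-- Functions on `ω × (0,T)` as functions on `Q` that do not depend on `x_d`. -/
noncomputable def liftL (hP : P.Admissible) : P.L2S →L[ℝ] P.L2Q :=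
  LinearMap.mkContinuous
    { toFun := fun f => (memLp_lift f).toLp
      map_add' := fun f g => by
        rw [← MemLp.toLp_add]
        refine MemLp.toLp_congr _ _ ?_
        exact quasiMeasurePreserving_lateral.ae (Lp.coeFn_add f g)
      map_smul' := fun c f => by
        rw [RingHom.id_apply, ← MemLp.toLp_const_smul]
        refine MemLp.toLp_congr _ _ ?_
        exact quasiMeasurePreserving_lateral.ae (Lp.coeFn_smul c f) }
    (√(2 * P.ℓ)) (fun f => by
      have hℓ := hP.ℓ_pos
      refine le_of_sq_le_sq ?_ (by positivity)
      rw [mul_pow, Real.sq_sqrt (by positivity)]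
      exact (norm_lift_sq hP f).le)

lemma coeFn_liftL (hP : P.Admissible) (f : P.L2S) :
    liftL hP f =ᵐ[P.measQ] fun p => f (p.1.1, p.2) :=
  (memLp_lift f).coeFn_toLp

/-- The operator `v ↦ ∫ R v dx_d`. -/
noncomputable def avgR (hP : P.Admissible) (v : P.L2Q) : P.L2S :=
  ContinuousLinearMap.adjoint (liftL hP) (mulL hP.R_bdd v)

lemma inner_avgR (hP : P.Admissible) (f : P.L2S) (v : P.L2Q) :
    inner ℝ f (avgR hP v) = inner ℝ (mulL hP.R_bdd (liftL hP f)) v := by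
  rw [avgR, ContinuousLinearMap.adjoint_inner_right, inner_mulL, real_inner_comm, inner_mulL]
  congr 1; ext p; ring

lemma coeFn_avgR (hP : P.Admissible) (v : P.L2Q) :
    ∀ᵐ y ∂P.measS,
      avgR hP v y = ∫ s in (-P.ℓ)..P.ℓ, P.R ((y.1, s), y.2) * v ((y.1, s), y.2) := by
  have hℓ := hP.ℓ_pos
  have := isFiniteMeasure_measQ hP
  have hfin : IsFiniteMeasure P.measS := by
    refine ⟨?_⟩
    rw [measS, Measure.restrict_apply_univ]
    exact (hP.isBounded_ω.prod (Metric.isBounded_Ioo _ _)).measure_lt_top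
  have hF : Integrable (fun p => P.R p * v p) P.measQ :=
    ((Lp.memLp (mulL hP.R_bdd v)).integrable one_le_two).congr (coeFn_mulL hP.R_bdd v)
  have hk := (integrable_swapRight hF).integral_prod_left
  have hkey : avgR hP v =ᵐ[P.measS]
      fun y => ∫ s in Ioo (-P.ℓ) P.ℓ, P.R ((y.1, s), y.2) * v ((y.1, s), y.2) := by
    refine Integrable.ae_eq_of_forall_setIntegral_eq _ _
      ((Lp.memLp _).integrable one_le_two) hk fun s hs hs' => ?_
    rw [← L2.inner_indicatorConstLp_one (𝕜 := ℝ) hs hs'.ne, inner_avgR, inner_mulL]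
    have h1 : ∀ᵐ p ∂P.measQ, liftL hP (indicatorConstLp 2 hs hs'.ne (1 : ℝ)) p
        = s.indicator (fun _ => (1 : ℝ)) (p.1.1, p.2) := by
      filter_upwards [coeFn_liftL hP (indicatorConstLp 2 hs hs'.ne (1 : ℝ)),
        quasiMeasurePreserving_lateral.ae (indicatorConstLp_coeFn (p := 2) (hs := hs)
          (hμs := hs'.ne) (c := (1 : ℝ)))] with p h1 h2
      rw [h1, h2]
    have h2 : ∫ p, P.R p * liftL hP (indicatorConstLp 2 hs hs'.ne (1 : ℝ)) p * v p ∂P.measQ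
        = ∫ p, s.indicator (fun _ => (1 : ℝ)) (p.1.1, p.2) * (P.R p * v p) ∂P.measQ := by
      refine integral_congr_ae ?_
      filter_upwards [h1] with p hp
      rw [hp]; ring
    have h3 : Integrable (fun p : SpaceTime n =>
        s.indicator (fun _ => (1 : ℝ)) (p.1.1, p.2) * (P.R p * v p)) P.measQ := by
      refine hF.bdd_mul (c := 1) ?_ (Eventually.of_forall fun p => ?_)
      · exact ((measurable_const.indicator hs).comp (by fun_prop)).aestronglyMeasurable
      · simp only [indicator]; split_ifs <;> simp
    rw [h2, integral_measQ_eq h3, ← integral_indicator hs]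
    congr 1; ext y
    simp only [indicator]
    split_ifs <;> simp
  filter_upwards [hkey] with y hy
  rw [hy, intervalIntegral.integral_of_le (by linarith), integral_Ioc_eq_integral_Ioo]

/-- The right-hand side of the direct problem. -/
noncomputable def directSource (hP : P.Admissible) (f : P.L2S) : P.Triple →L[ℝ] ℝ :=
  (innerBilin P.L2Q (mulL hP.R_bdd (liftL hP f))).comp fnL

/-- The right-hand side of the adjoint problem. -/
noncomputable def adjointSource (ψ : P.L2S) : P.Triple →L[ℝ] ℝ :=
  (innerBilin P.L2S ψ).comp traceL

lemma directSource_apply (hP : P.Admissible) (f : P.L2S) (x : P.Triple) :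
    directSource hP f x = inner ℝ f (avgR hP (fnL x)) := by
  rw [inner_avgR]; rfl

lemma directSource_testTriple (hP : P.Admissible) (f : P.L2S) (Φ : P.testSpace) :
    directSource hP f (testTriple Φ)
      = ∫ p : SpaceTime n, f (p.1.1, p.2) * P.R p * (Φ : SpaceTime n → ℝ) p ∂P.measQ := by
  have : directSource hP f (testTriple Φ) = inner ℝ (mulL hP.R_bdd (liftL hP f)) (val Φ) := rfl
  rw [this, inner_mulL]
  refine integral_congr_ae ?_
  filter_upwards [coeFn_liftL hP f, coeFn_val Φ] with p h1 h2
  rw [h1, h2, mul_comm (P.R p)]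

lemma adjointSource_testTriple (ψ : P.L2S) (Φ : P.testSpace) :
    adjointSource ψ (testTriple Φ)
      = ∫ y, ψ y * (Φ : SpaceTime n → ℝ) ((y.1, P.ℓ), y.2) ∂P.measS := by
  have : adjointSource ψ (testTriple Φ) = inner ℝ ψ (trace Φ) := rfl
  rw [this, inner_L2_eq]
  refine integral_congr_ae ?_
  filter_upwards [coeFn_trace Φ] with p h
  rw [h]

lemma isDirectSolution_iff (hP : P.Admissible) (f : P.L2S) (u : P.L2Q) (τ : P.L2S) :
    P.IsDirectSolution f u τ ↔
      ∃ x ∈ P.energySpace, fnL x = u ∧ traceL x = τ ∧ DirectWeak hP (directSource hP f) x := by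
  constructor
  · rintro ⟨G, hG, h⟩
    refine ⟨mkTriple u G τ, (isEnergy_iff u G τ).1 hG, rfl, rfl, fun Φ hΦ => ?_⟩
    rw [energyForm_testTriple, directSource_testTriple, ← h Φ Φ.2 hΦ, integral_leftFracInt_dt hP]
    rfl
  · rintro ⟨x, hx, rfl, rfl, h⟩
    refine ⟨fun i => gradL i x, (isEnergy_iff _ _ _).2 (by rwa [mkTriple_components]),
      fun Φ hΦ hs => ?_⟩
    have := h ⟨Φ, hΦ⟩ hs
    rw [energyForm_testTriple, directSource_testTriple, ← integral_leftFracInt_dt hP] at this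
    exact this

lemma isAdjointSolution_iff (hP : P.Admissible) (ψ : P.L2S) (v : P.L2Q) :
    P.IsAdjointSolution ψ v ↔
      ∃ x ∈ P.energySpace, fnL x = v ∧ AdjointWeak hP (adjointSource ψ) x := by
  constructor
  · rintro ⟨G, τ, hG, h⟩
    refine ⟨mkTriple v G τ, (isEnergy_iff v G τ).1 hG, rfl, fun Φ hΦ => ?_⟩
    rw [energyForm_testTriple, adjointSource_testTriple, ← h Φ Φ.2 hΦ,
      integral_rightFracInt_dt hP]
    rfl
  · rintro ⟨x, hx, rfl, h⟩
    refine ⟨fun i => gradL i x, traceL x, (isEnergy_iff _ _ _).2 (by rwa [mkTriple_components]),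
      fun Φ hΦ hs => ?_⟩
    have := h ⟨Φ, hΦ⟩ hs
    rw [energyForm_testTriple, adjointSource_testTriple, ← integral_rightFracInt_dt hP] at this
    exact this

lemma existsUnique_directSolution (hn : 1 ≤ n) (hP : P.Admissible) (f : P.L2S) :
    ∃! w : P.L2Q × P.L2S, P.IsDirectSolution f w.1 w.2 := by
  obtain ⟨x, hx, h⟩ := exists_directWeak hn hP (directSource hP f)
  refine ⟨(fnL x, traceL x), (isDirectSolution_iff hP f _ _).2 ⟨x, hx, rfl, rfl, h⟩, ?_⟩
  rintro ⟨u, τ⟩ hw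
  obtain ⟨y, hy, rfl, rfl, h'⟩ := (isDirectSolution_iff hP f _ _).1 hw
  rw [h.unique hn hx hy h']

lemma existsUnique_adjointSolution (hn : 1 ≤ n) (hP : P.Admissible) (ψ : P.L2S) :
    ∃! v : P.L2Q, P.IsAdjointSolution ψ v := by
  obtain ⟨x, hx, h⟩ := exists_adjointWeak hn hP (adjointSource ψ)
  refine ⟨fnL x, (isAdjointSolution_iff hP ψ _).2 ⟨x, hx, rfl, h⟩, ?_⟩
  intro v hv
  obtain ⟨y, hy, rfl, h'⟩ := (isAdjointSolution_iff hP ψ _).1 hv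
  rw [h.unique hn hx hy h']

/-- The adjoint problem represents the adjoint of the observation operator. -/
lemma inner_avgR_eq_inner_observation (hn : 1 ≤ n) (hP : P.Admissible) {ψ : P.L2S} {v : P.L2Q}
    (hv : P.IsAdjointSolution ψ v) (f : P.L2S) :
    inner ℝ f (avgR hP v) = inner ℝ ψ (P.observation f) := by
  have hs : P.IsDirectSolution f (P.solution f).1 (P.solution f).2 :=
    Classical.epsilon_spec (p := fun w : P.L2Q × P.L2S => P.IsDirectSolution f w.1 w.2)
      (existsUnique_directSolution hn hP f).exists
  obtain ⟨x, hx, -, hτ, h⟩ := (isDirectSolution_iff hP f _ _).1 hs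
  obtain ⟨y, hy, rfl, h'⟩ := (isAdjointSolution_iff hP ψ _).1 hv
  rw [← directSource_apply, weak_duality hn hP hx hy h h', observation, ← hτ]
  rfl

/-- The observation as a bounded operator. -/
lemma exists_observationL (hn : 1 ≤ n) (hP : P.Admissible) :
    ∃ O : P.L2S →L[ℝ] P.L2S, ∀ f, O f = P.observation f := by
  choose Z hZ using fun ψ => (existsUnique_adjointSolution hn hP ψ).exists
  have key : ∀ ψ f, inner ℝ ψ (P.observation f) = inner ℝ f (avgR hP (Z ψ)) := fun ψ f =>
    (inner_avgR_eq_inner_observation hn hP (hZ ψ) f).symm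
  let O : P.L2S →ₗ[ℝ] P.L2S :=
    { toFun := P.observation
      map_add' := fun f g => ext_inner_left ℝ fun ψ => by
        simp only [inner_add_right, key, inner_add_left]
      map_smul' := fun c f => ext_inner_left ℝ fun ψ => by
        simp only [inner_smul_right, key, real_inner_smul_left, RingHom.id_apply] }
  refine ⟨⟨O, O.continuous_of_seq_closed_graph fun u x y hu hy => ?_⟩, fun f => rfl⟩
  refine ext_inner_left ℝ fun ψ => ?_
  have h1 : Tendsto (fun k => inner ℝ ψ (O (u k))) atTop (𝓝 (inner ℝ ψ y)) :=
    tendsto_const_nhds.inner hy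
  have h2 : Tendsto (fun k => inner ℝ ψ (O (u k))) atTop (𝓝 (inner ℝ ψ (O x))) := by
    have : ∀ f, inner ℝ ψ (O f) = inner ℝ f (avgR hP (Z ψ)) := key ψ
    simp only [this]
    exact hu.inner tendsto_const_nhds
  exact tendsto_nhds_unique h1 h2

lemma hasGradientAt_misfit (hn : 1 ≤ n) (hP : P.Admissible) (g f : P.L2S) {v : P.L2Q}
    (hv : P.IsAdjointSolution (P.observation f - g) v) :
    HasGradientAt (P.misfit g) (avgR hP v) f := by
  obtain ⟨O, hO⟩ := exists_observationL hn hP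
  have h := ((O.hasFDerivAt (x := f)).sub_const g).norm_sq.const_mul (1 / 2 : ℝ)
  have e : P.misfit g = fun f => 1 / 2 * ‖O f - g‖ ^ 2 := by
    ext f; rw [misfit, hO]
  rw [hasGradientAt_iff_hasFDerivAt, e]
  refine h.congr_fderiv ?_
  ext k
  have := inner_avgR_eq_inner_observation hn hP hv k
  rw [← hO, ← hO] at this
  rw [InnerProductSpace.toDual_apply_apply, real_inner_comm, this]
  simp [inner_sub_left]

end Problem
end Subdiffusion

theorem mainTheorem6 (n : ℕ) (hn : 1 ≤ n) (P : Subdiffusion.Problem n) (hP : P.Admissible)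
    (g : P.L2S) :
    (∀ f : P.L2S, ∃! w : P.L2Q × P.L2S, P.IsDirectSolution f w.1 w.2) ∧
    (∀ ψ : P.L2S, ∃! v : P.L2Q, P.IsAdjointSolution ψ v) ∧
    ∀ (f : P.L2S) (v : P.L2Q), P.IsAdjointSolution (P.observation f - g) v →
      ∃ G : P.L2S,
        (∀ᵐ y ∂P.measS, G y = ∫ s in (-P.ℓ)..P.ℓ, P.R ((y.1, s), y.2) * v ((y.1, s), y.2)) ∧
        HasGradientAt (P.misfit g) G f := by
  refine ⟨fun f => Subdiffusion.Problem.existsUnique_directSolution hn hP f,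
    fun ψ => Subdiffusion.Problem.existsUnique_adjointSolution hn hP ψ, fun f v hv => ?_⟩
  exact ⟨Subdiffusion.Problem.avgR hP v, Subdiffusion.Problem.coeFn_avgR hP v,
    Subdiffusion.Problem.hasGradientAt_misfit hn hP g f hv⟩
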